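/- Let $0<\alpha<1$, let $R=\{x\in\mathbb R^2: x_1\ge 0,\ x_2\ge 0\}$, and let $C^1_0(R)$ be the space of functions that are $C^1$ on $R$ up to the boundary and have compact support in $R$ (the support is allowed to meet $\partial R$), with the norm $\sup_R|f|+\sup_R|\nabla f|$. Consider the hyperbolic SQG equation on $R$ $$\partial_t\omega+u\cdot\nabla\omega=0,\qquad \omega(x,0)=\omega_0(x),$$ with the modified Biot–Savart law $$u(x,t)=\bigl(-x_1\,\Omega(x,t),\ x_2\,\Omega(x,t)\bigr),\qquad \Omega(x,t)=\int_{\{y\in R:\ y_1y_2\ge x_1x_2\}}\frac{\omega(y,t)}{|y|^{2+\alpha}}\,dy .$$ A solution on $[0,T]$ is a function $\omega\in C([0,T];C^1_0(R))$ with $\omega(\cdot,0)=\omega_0$ such that the integral defining $\Omega(x,t)$ converges absolutely and the equation holds at every $x\in R$ and every $t\in[0,T]$ (with one-sided derivatives at the boundary of $R$ and at the end points of $[0,T]$). **Theorem.** Let $\omega_0\in C^1_0(R)$ be such that the origin does not belong to the support of $\omega_0$. Then there is $T=T(\omega_0,\alpha)>0$ such that the hyperbolic SQG equation has a unique solution $\omega\in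 C([0,T];C^1_0(R))$. -/

import Mathlib

open Set Filter Topology MeasureTheory

namespace HyperbolicSQG

/-- The Euclidean plane. -/
abbrev Plane : Type := EuclideanSpace ℝ (Fin 2)

/-- The closed first quadrant `R`. -/
def quadrant : Set Plane := {x | 0 ≤ x 0 ∧ 0 ≤ x 1}

/-- The support in `R` of a function on `R`. Functions on `R` are represented by functions on the
plane whose values outside `R` are never used; as `R` is closed, the closure in the plane is the
closure in `R`. -/
def quadrantSupport (f : Plane → ℝ) : Set Plane :=
  closure {x | x ∈ quadrant ∧ f x ≠ 0}

/-- The class `C¹₀(R)`: functions that are `C¹` on `R` up to the boundary, with compact support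
in `R` (which may meet the boundary of `R`). -/
def IsC10 (f : Plane → ℝ) : Prop :=
  ContDiffOn ℝ 1 f quadrant ∧ IsCompact (quadrantSupport f)

/-- `ω ∈ C(I; C¹₀(R))`, where `C¹₀(R)` carries the norm `sup_R |f| + sup_R |∇f|`: convergence in
this norm is uniform convergence on `R` of the functions and of their gradients. -/
def IsC10Path (I : Set ℝ) (ω : ℝ → Plane → ℝ) : Prop :=
  (∀ t ∈ I, IsC10 (ω t)) ∧
  ∀ t ∈ I,
    TendstoUniformlyOn ω (ω t) (𝓝[I] t) quadrant ∧
    TendstoUniformlyOn (fun s => fderivWithin ℝ (ω s) quadrant)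
      (fderivWithin ℝ (ω t) quadrant) (𝓝[I] t) quadrant

/-- The domain of integration `{y ∈ R : y₁ y₂ ≥ x₁ x₂}`. -/
def region (x : Plane) : Set Plane := {y | y ∈ quadrant ∧ x 0 * x 1 ≤ y 0 * y 1}

/-- The integrand `f(y) / |y|^(2+α)` of the Biot–Savart law. -/
noncomputable def bsIntegrand (α : ℝ) (f : Plane → ℝ) (y : Plane) : ℝ :=
  f y / ‖y‖ ^ (2 + α)

/-- `Ω(x) = ∫_{y₁ y₂ ≥ x₁ x₂} f(y) / |y|^(2+α) dy`. -/
noncomputable def bigOmega (α : ℝ) (f : Plane → ℝ) (x : Plane) : ℝ :=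
  ∫ y in region x, bsIntegrand α f y

/-- The velocity `u = (-x₁ Ω, x₂ Ω)`. -/
noncomputable def velocity (α : ℝ) (f : Plane → ℝ) (x : Plane) : Plane :=
  !₂[-(x 0) * bigOmega α f x, x 1 * bigOmega α f x]

/-- `ω ∈ C([0,T]; C¹₀(R))` is a classical solution on `[0,T]` of
`∂ₜω + u · ∇ω = 0`, `ω(·,0) = ω₀`, with `u` the velocity generated by `ω(·,t)`: the integral
that defines `u` converges at every point, and the equation holds at every point of `R` and
every time in `[0,T]` (with one-sided derivatives at the boundary of `R` and at the ends of
`[0,T]`). -/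
structure IsSolution (α : ℝ) (ω₀ : Plane → ℝ) (T : ℝ) (ω : ℝ → Plane → ℝ) : Prop where
  path : IsC10Path (Icc 0 T) ω
  initial : ∀ x ∈ quadrant, ω 0 x = ω₀ x
  converges : ∀ t ∈ Icc 0 T, ∀ x ∈ quadrant, IntegrableOn (bsIntegrand α (ω t)) (region x)
  equation : ∀ t ∈ Icc 0 T, ∀ x ∈ quadrant, ∃ ωt : ℝ,
    HasDerivWithinAt (fun s => ω s x) ωt (Icc 0 T) t ∧
    ωt + fderivWithin ℝ (ω t) quadrant x (velocity α (ω t) x) = 0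

end HyperbolicSQG

/-!
# Local well-posedness of the hyperbolic SQG equation

The velocity is tangent to the hyperbolas `x₁ x₂ = s`, and on each of them `Ω` is constant in
space. So the flow up to time `t` acts on the hyperbola of parameter `s` as a hyperbolic rotation,
`(x₁, x₂) ↦ (x₁ e^{-A}, x₂ e^A)` with `A(t, s) = ∫₀ᵗ Ω(τ, s) dτ`, and a solution has the form
`ω(t, x) = ω₀(x₁ e^A, x₂ e^{-A})`, i.e. `ω(t, ·) = ω₀ ∘ shear (A t)`. In the area-preserving
coordinates `(σ, p)` of the point `(e^p, σ e^{-p})` the flow only translates `p`, so that the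
Biot–Savart law becomes `Ω(t, s) = ∫_s^∞ G(σ, A(t, σ)) dσ` (`bigOmega_eq_integral_flux`), where
`G = flux` depends on `ω₀` alone. The whole problem is thereby reduced to
`∂ₜ A(t, s) = ∫_s^∞ G(σ, A(t, σ)) dσ`, `A(0, ·) = 0`.

As `ω₀` has compact support away from the origin, `G` is locally Lipschitz in its second variable
and vanishes for large `σ`. The delicate point is its continuity as `σ → 0`, where the hyperbola
degenerates into the two axes: the weights `y₁² / |y|²` and `y₂² / |y|²` split `G` into two
integrals with a majorant that does not depend on `σ` (`continuous_flux`).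

*Existence.* The Picard–Lindelöf theorem for `B = -∂ₛ A` in `C([0, S])` gives `A`, continuously
differentiable in `s` up to `s = 0` (`exists_shear_path`). Then `ω₀ ∘ shear (A t)` is a path in
`C¹₀(R)`, because it and its gradient are jointly continuous and supported in a fixed compact set,
and it solves the equation (`isSolution_shear`).

*Uniqueness.* For any solution and any `s > 0`, `Ω(t, s)` is continuous in `t`, since the kernel is
integrable on `y₁ y₂ ≥ s`. Hence the solution is constant along its trajectories off the axes and
is again of the form `ω₀ ∘ shear (A t)` there (`IsSolution.eq_shear`). The values of `A` on
`[s₀, ∞)` solve a closed equation, and they are bounded for `s₀ > 0`; so Grönwall's argument shows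
that two solutions have the same `A` on `(0, ∞)` (`IsSolution.flowShear_eq`). They agree on the
open quadrant and, by continuity, on `R`. No bound near `s = 0` is needed for this.
-/

namespace HyperbolicSQG

/-! ### The vorticity flux across a hyperbola -/

/-- The square of the distance to the origin of the point `(e^p, σ e^{-p})` of the hyperbola
`y₁ y₂ = σ`. -/
noncomputable def hypSq (p σ : ℝ) : ℝ := Real.exp (2 * p) + σ ^ 2 * Real.exp (-(2 * p))

lemma hypSq_pos (p σ : ℝ) : 0 < hypSq p σ := by
  unfold hypSq; positivity

lemma hypSq_sub_le {a r : ℝ} (ha : |a| ≤ r) (p σ : ℝ) :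
    Real.exp (-(2 * r)) * hypSq p σ ≤ hypSq (p - a) σ := by
  obtain ⟨h1, h2⟩ := abs_le.1 ha
  unfold hypSq
  rw [mul_add]
  have e1 : Real.exp (-(2 * r)) * Real.exp (2 * p) ≤ Real.exp (2 * (p - a)) := by
    rw [← Real.exp_add]; exact Real.exp_le_exp.2 (by linarith)
  have e2 : Real.exp (-(2 * r)) * Real.exp (-(2 * p)) ≤ Real.exp (-(2 * (p - a))) := by
    rw [← Real.exp_add]; exact Real.exp_le_exp.2 (by linarith)
  have := mul_le_mul_of_nonneg_left e2 (sq_nonneg σ)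
  linarith

lemma continuous_hypSq : Continuous fun z : ℝ × ℝ => hypSq z.1 z.2 := by
  unfold hypSq; fun_prop

lemma hypSq_reflect {σ : ℝ} (hσ : 0 < σ) (q : ℝ) : hypSq (Real.log σ - q) σ = hypSq q σ := by
  have h1 : Real.exp (2 * (Real.log σ - q)) = σ ^ 2 * Real.exp (-(2 * q)) := by
    rw [show 2 * (Real.log σ - q) = Real.log σ + Real.log σ + -(2 * q) by ring, Real.exp_add,
      Real.exp_add, Real.exp_log hσ]
    ring
  have h2 : σ ^ 2 * Real.exp (-(2 * (Real.log σ - q))) = Real.exp (2 * q) := by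
    rw [show -(2 * (Real.log σ - q)) = -Real.log σ + -Real.log σ + 2 * q by ring, Real.exp_add,
      Real.exp_add, Real.exp_neg, Real.exp_log hσ]
    field_simp
  unfold hypSq
  rw [h1, h2]; ring

/-- A continuous bounded function `w(a, b)` of two real variables which vanishes for
`a² + b² < δ²`, for `a > M` and for `b > M`: what is kept of the initial vorticity, as a
function of the coordinates, for the analysis of the Biot–Savart integral. -/
structure IsProfile (w : ℝ → ℝ → ℝ) (δ M C : ℝ) : Prop where
  pos_inner : 0 < δ
  pos_outer : 0 < M
  cont : Continuous fun z : ℝ × ℝ => w z.1 z.2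
  bound : ∀ a b, |w a b| ≤ C
  lower : ∀ a b, w a b ≠ 0 → δ ^ 2 ≤ a ^ 2 + b ^ 2
  upper_left : ∀ a b, w a b ≠ 0 → a ≤ M
  upper_right : ∀ a b, w a b ≠ 0 → b ≤ M

lemma IsProfile.swap {w : ℝ → ℝ → ℝ} {δ M C : ℝ} (h : IsProfile w δ M C) :
    IsProfile (fun a b => w b a) δ M C where
  pos_inner := h.pos_inner
  pos_outer := h.pos_outer
  cont := h.cont.comp continuous_swap
  bound a b := h.bound b a
  lower a b hab := by rw [add_comm]; exact h.lower b a hab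
  upper_left a b hab := h.upper_right b a hab
  upper_right a b hab := h.upper_left b a hab

/-- The part of the initial vorticity on the hyperbola `y₁ y₂ = σ` that is concentrated near the
`y₁`-axis: the weight `y₁² / |y|²` makes it integrable in `p`, uniformly as `σ` tends to `0`. -/
noncomputable def axialDensity (w : ℝ → ℝ → ℝ) (σ p : ℝ) : ℝ :=
  w (Real.exp p) (σ * Real.exp (-p)) * (Real.exp (2 * p) / hypSq p σ)

/-- The contribution of the vorticity near the `y₁`-axis to the Biot–Savart integral over the
hyperbola `y₁ y₂ = σ`, after this hyperbola has been shifted by `a`. The exponent `2β` plays the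
role of `2 + α`. -/
noncomputable def axialFlux (β : ℝ) (w : ℝ → ℝ → ℝ) (σ a : ℝ) : ℝ :=
  ∫ p, axialDensity w σ p * hypSq (p - a) σ ^ (-β)

/-- The Biot–Savart integral over the hyperbola `y₁ y₂ = σ` of the profile `w` shifted by `a`
along the hyperbola; the two terms are the contributions of the neighbourhoods of the axes. -/
noncomputable def flux (β : ℝ) (w : ℝ → ℝ → ℝ) (σ a : ℝ) : ℝ :=
  axialFlux β w σ a + axialFlux β (fun x y => w y x) σ (-a)

/-- An integrable majorant of `axialDensity w σ`, uniform in `σ`. -/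
noncomputable def axialMajorant (δ M C : ℝ) : ℝ → ℝ :=
  (Iic (Real.log M)).indicator fun p => C / δ ^ 2 * Real.exp (2 * p)

lemma integrable_axialMajorant (δ M C : ℝ) : Integrable (axialMajorant δ M C) := by
  unfold axialMajorant
  rw [integrable_indicator_iff measurableSet_Iic]
  exact (integrableOn_exp_mul_Iic two_pos _).const_mul _

section

variable {β : ℝ} {w : ℝ → ℝ → ℝ} {δ M C : ℝ}

lemma IsProfile.nonneg (h : IsProfile w δ M C) : 0 ≤ C := (abs_nonneg _).trans (h.bound 0 0)

lemma exp_sq_add (p σ : ℝ) : Real.exp p ^ 2 + (σ * Real.exp (-p)) ^ 2 = hypSq p σ := by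
  unfold hypSq
  rw [mul_pow, ← Real.exp_nat_mul, ← Real.exp_nat_mul]
  congr 3
  push_cast; ring_nf

lemma axialDensity_ne_zero (h : IsProfile w δ M C) {σ p : ℝ} (hne : axialDensity w σ p ≠ 0) :
    δ ^ 2 ≤ hypSq p σ ∧ p ≤ Real.log M := by
  have hw := left_ne_zero_of_mul hne
  refine ⟨(h.lower _ _ hw).trans_eq (exp_sq_add p σ), ?_⟩
  rw [Real.le_log_iff_exp_le h.pos_outer]
  exact h.upper_left _ _ hw

lemma abs_axialDensity_le (h : IsProfile w δ M C) (σ p : ℝ) :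
    |axialDensity w σ p| ≤ axialMajorant δ M C p := by
  have hC := h.nonneg
  by_cases hne : axialDensity w σ p = 0
  · rw [hne, abs_zero]
    exact indicator_nonneg (fun _ _ => by positivity) _
  · obtain ⟨h1, h2⟩ := axialDensity_ne_zero h hne
    rw [axialMajorant, indicator_of_mem (mem_Iic.2 h2), axialDensity, abs_mul, abs_div,
      abs_of_pos (Real.exp_pos _), abs_of_pos (hypSq_pos _ _), div_mul_eq_mul_div, mul_div_assoc]
    have := h.pos_inner
    exact mul_le_mul (h.bound _ _) (by gcongr) (by have := hypSq_pos p σ; positivity) hC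

lemma axialMajorant_nonneg (h : IsProfile w δ M C) (p : ℝ) : 0 ≤ axialMajorant δ M C p :=
  (abs_nonneg _).trans (abs_axialDensity_le h 0 p)

lemma continuous_axialDensity (h : IsProfile w δ M C) :
    Continuous fun z : ℝ × ℝ => axialDensity w z.1 z.2 := by
  unfold axialDensity
  refine Continuous.mul (h.cont.comp (f := fun z : ℝ × ℝ => (Real.exp z.2, z.1 * Real.exp (-z.2)))
    (by fun_prop)) (Continuous.div (by fun_prop)
      (continuous_hypSq.comp (f := fun z : ℝ × ℝ => (z.2, z.1)) (by fun_prop))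
      fun z => (hypSq_pos _ _).ne')

lemma continuous_axialIntegrand (h : IsProfile w δ M C) :
    Continuous fun z : (ℝ × ℝ) × ℝ =>
      axialDensity w z.1.1 z.2 * hypSq (z.2 - z.1.2) z.1.1 ^ (-β) := by
  refine Continuous.mul ((continuous_axialDensity h).comp
    (f := fun z : (ℝ × ℝ) × ℝ => (z.1.1, z.2)) (by fun_prop)) (Continuous.rpow_const
      (continuous_hypSq.comp (f := fun z : (ℝ × ℝ) × ℝ => (z.2 - z.1.2, z.1.1)) (by fun_prop))
      fun z => Or.inl (hypSq_pos _ _).ne')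

/-- The bound of the shifted kernel on the support of the profile, for shifts at most `r`. -/
noncomputable def kernelBound (β δ r : ℝ) : ℝ := (Real.exp (-(2 * r)) * δ ^ 2) ^ (-β)

lemma kernel_le (hβ : 0 ≤ β) (hδ : 0 < δ) {r a p σ : ℝ} (ha : |a| ≤ r) (hp : δ ^ 2 ≤ hypSq p σ) :
    hypSq (p - a) σ ^ (-β) ≤ kernelBound β δ r := by
  refine Real.rpow_le_rpow_of_nonpos (by positivity) ?_ (by linarith)
  exact (mul_le_mul_of_nonneg_left hp (Real.exp_pos _).le).trans (hypSq_sub_le ha p σ)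

lemma kernelBound_nonneg (β δ r : ℝ) : 0 ≤ kernelBound β δ r := by
  unfold kernelBound; positivity

lemma abs_axialIntegrand_le (hβ : 0 ≤ β) (h : IsProfile w δ M C) {r a : ℝ} (ha : |a| ≤ r)
    (σ p : ℝ) : |axialDensity w σ p * hypSq (p - a) σ ^ (-β)| ≤
      axialMajorant δ M C p * kernelBound β δ r := by
  by_cases hne : axialDensity w σ p = 0
  · rw [hne, zero_mul, abs_zero]
    exact mul_nonneg (axialMajorant_nonneg h p) (kernelBound_nonneg _ _ _)
  · rw [abs_mul, abs_of_pos (Real.rpow_pos_of_pos (hypSq_pos _ _) _)]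
    exact mul_le_mul (abs_axialDensity_le h σ p)
      (kernel_le hβ h.pos_inner ha (axialDensity_ne_zero h hne).1)
      (Real.rpow_pos_of_pos (hypSq_pos _ _) _).le (axialMajorant_nonneg h p)

lemma integrable_axialIntegrand (hβ : 0 ≤ β) (h : IsProfile w δ M C) (σ a : ℝ) :
    Integrable fun p => axialDensity w σ p * hypSq (p - a) σ ^ (-β) := by
  refine ((integrable_axialMajorant δ M C).mul_const (kernelBound β δ |a|)).mono'
    ((continuous_axialIntegrand (β := β) h).comp (f := fun p : ℝ => ((σ, a), p))
      (by fun_prop)).aestronglyMeasurable (ae_of_all _ fun p => ?_)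
  exact abs_axialIntegrand_le hβ h le_rfl σ p

lemma continuous_axialFlux (hβ : 0 ≤ β) (h : IsProfile w δ M C) :
    Continuous fun z : ℝ × ℝ => axialFlux β w z.1 z.2 := by
  rw [continuous_iff_continuousAt]
  intro z₀
  unfold axialFlux
  refine MeasureTheory.continuousAt_of_dominated
    (bound := fun p => axialMajorant δ M C p * kernelBound β δ (|z₀.2| + 1)) ?_ ?_
    ((integrable_axialMajorant δ M C).mul_const _) ?_
  · exact Eventually.of_forall fun z => ((continuous_axialIntegrand (β := β) h).comp
      (f := fun p : ℝ => (z, p)) (by fun_prop)).aestronglyMeasurable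
  · have : ∀ᶠ z : ℝ × ℝ in 𝓝 z₀, |z.2| < |z₀.2| + 1 :=
      (continuous_snd.abs.tendsto z₀).eventually (gt_mem_nhds (by linarith))
    filter_upwards [this] with z hz
    exact ae_of_all _ fun p => abs_axialIntegrand_le hβ h hz.le z.1 p
  · exact ae_of_all _ fun p => ((continuous_axialIntegrand (β := β) h).comp
      (f := fun z : ℝ × ℝ => (z, p)) (by fun_prop)).continuousAt

lemma continuous_flux (hβ : 0 ≤ β) (h : IsProfile w δ M C) :
    Continuous fun z : ℝ × ℝ => flux β w z.1 z.2 := by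
  unfold flux
  exact (continuous_axialFlux hβ h).add ((continuous_axialFlux hβ h.swap).comp
    (f := fun z : ℝ × ℝ => (z.1, -z.2)) (by fun_prop))

lemma hasDerivAt_kernel (β p σ a : ℝ) :
    HasDerivAt (fun a => hypSq (p - a) σ ^ (-β))
      ((-(2 * Real.exp (2 * (p - a))) + σ ^ 2 * (2 * Real.exp (-(2 * (p - a))))) * -β *
        hypSq (p - a) σ ^ (-β - 1)) a := by
  refine HasDerivAt.rpow_const ?_ (Or.inl (hypSq_pos _ _).ne')
  have h0 : HasDerivAt (fun a : ℝ => 2 * (p - a)) (-2) a := by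
    simpa using ((hasDerivAt_id a).const_sub p).const_mul 2
  have h := h0.exp.add (h0.neg.exp.const_mul (σ ^ 2))
  refine h.congr_deriv ?_
  simp only [Pi.neg_apply]
  ring

lemma abs_kernel_sub_le (hβ : 0 ≤ β) (hδ : 0 < δ) {r a b p σ : ℝ} (ha : |a| ≤ r) (hb : |b| ≤ r)
    (hp : δ ^ 2 ≤ hypSq p σ) :
    |hypSq (p - a) σ ^ (-β) - hypSq (p - b) σ ^ (-β)| ≤
      2 * β * kernelBound β δ r * |a - b| := by
  refine (convex_Icc (-r) r).norm_image_sub_le_of_norm_hasDerivWithin_le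
    (f := fun a => hypSq (p - a) σ ^ (-β))
    (fun c _ => (hasDerivAt_kernel β p σ c).hasDerivWithinAt) ?_ (abs_le.1 hb) (abs_le.1 ha)
  intro c hc
  have hq := hypSq_pos (p - c) σ
  have e1 : |(-(2 * Real.exp (2 * (p - c))) + σ ^ 2 * (2 * Real.exp (-(2 * (p - c)))))| ≤
      2 * hypSq (p - c) σ := by
    have h1 := Real.exp_pos (2 * (p - c))
    have h2 : 0 ≤ σ ^ 2 * Real.exp (-(2 * (p - c))) := by positivity
    rw [abs_le]; unfold hypSq
    constructor <;> nlinarith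
  rw [Real.norm_eq_abs, abs_mul, abs_mul, abs_neg, abs_of_nonneg hβ,
    abs_of_pos (Real.rpow_pos_of_pos hq _), Real.rpow_sub_one hq.ne']
  calc _ ≤ 2 * hypSq (p - c) σ * β * (hypSq (p - c) σ ^ (-β) / hypSq (p - c) σ) := by
        gcongr
    _ = 2 * β * hypSq (p - c) σ ^ (-β) := by field_simp
    _ ≤ _ := by
        have := kernel_le hβ hδ (abs_le.2 hc) hp
        gcongr

lemma exists_lipschitz_axialFlux (hβ : 0 ≤ β) (h : IsProfile w δ M C) (r : ℝ) :
    ∃ L, 0 ≤ L ∧ ∀ σ a b, |a| ≤ r → |b| ≤ r →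
      |axialFlux β w σ a - axialFlux β w σ b| ≤ L * |a - b| := by
  refine ⟨(∫ p, axialMajorant δ M C p) * (2 * β * kernelBound β δ r),
    mul_nonneg (integral_nonneg fun p => axialMajorant_nonneg h p)
      (mul_nonneg (by positivity) (kernelBound_nonneg _ _ _)), ?_⟩
  intro σ a b ha hb
  unfold axialFlux
  rw [← integral_sub (integrable_axialIntegrand hβ h σ a) (integrable_axialIntegrand hβ h σ b),
    mul_assoc, ← integral_mul_const]
  refine (Real.norm_eq_abs _).symm.le.trans (norm_integral_le_of_norm_le
    ((integrable_axialMajorant δ M C).mul_const _) (ae_of_all _ fun p => ?_))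
  rw [Real.norm_eq_abs, ← mul_sub, abs_mul]
  by_cases hne : axialDensity w σ p = 0
  · rw [hne, abs_zero, zero_mul]
    exact mul_nonneg (axialMajorant_nonneg h p) (mul_nonneg
      (mul_nonneg (by positivity) (kernelBound_nonneg _ _ _)) (abs_nonneg _))
  · exact mul_le_mul (abs_axialDensity_le h σ p)
      (abs_kernel_sub_le hβ h.pos_inner ha hb (axialDensity_ne_zero h hne).1)
      (abs_nonneg _) (axialMajorant_nonneg h p)

lemma exists_lipschitz_flux (hβ : 0 ≤ β) (h : IsProfile w δ M C) (r : ℝ) :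
    ∃ L, 0 ≤ L ∧ ∀ σ a b, |a| ≤ r → |b| ≤ r → |flux β w σ a - flux β w σ b| ≤ L * |a - b| := by
  obtain ⟨L₁, h₁, H₁⟩ := exists_lipschitz_axialFlux hβ h r
  obtain ⟨L₂, h₂, H₂⟩ := exists_lipschitz_axialFlux hβ h.swap r
  refine ⟨L₁ + L₂, add_nonneg h₁ h₂, fun σ a b ha hb => ?_⟩
  have e₁ := H₁ σ a b ha hb
  have e₂ := H₂ σ (-a) (-b) (by rwa [abs_neg]) (by rwa [abs_neg])
  rw [neg_sub_neg, abs_sub_comm b a] at e₂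
  unfold flux
  rw [add_sub_add_comm, add_mul]
  exact (abs_add_le _ _).trans (add_le_add e₁ e₂)

lemma axialFlux_eq_zero (h : IsProfile w δ M C) {σ : ℝ} (hσ : M ^ 2 < σ) (a : ℝ) :
    axialFlux β w σ a = 0 := by
  unfold axialFlux
  rw [← integral_zero ℝ ℝ]
  congr 1
  ext p
  by_contra hne
  have hw := left_ne_zero_of_mul (left_ne_zero_of_mul hne)
  have h1 := h.upper_left _ _ hw
  have h2 := h.upper_right _ _ hw
  have hσ0 : 0 < σ := (sq_nonneg M).trans_lt hσ
  have : Real.exp p * (σ * Real.exp (-p)) = σ := by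
    rw [mul_left_comm, ← Real.exp_add]; simp
  have := mul_le_mul h1 h2 (by positivity) h.pos_outer.le
  nlinarith

lemma flux_eq_zero (h : IsProfile w δ M C) {σ : ℝ} (hσ : M ^ 2 < σ) (a : ℝ) :
    flux β w σ a = 0 := by
  rw [flux, axialFlux_eq_zero h hσ, axialFlux_eq_zero h.swap hσ, add_zero]

/-- On a hyperbola off the axes the vorticity is the sum of its two axial parts; the reflection
`p ↦ log σ - p` exchanges the roles of the coordinates, and with them the axes. -/
lemma integral_shift_eq_flux (hβ : 0 ≤ β) (h : IsProfile w δ M C) {σ : ℝ} (hσ : 0 < σ) (a : ℝ) :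
    ∫ p, w (Real.exp (p + a)) (σ * Real.exp (-(p + a))) * hypSq p σ ^ (-β) = flux β w σ a := by
  have hre : ∀ q, Real.exp (Real.log σ - q) = σ * Real.exp (-q) := fun q => by
    rw [sub_eq_add_neg, Real.exp_add, Real.exp_log hσ]
  have hre' : ∀ q, σ * Real.exp (-(Real.log σ - q)) = Real.exp q := fun q => by
    rw [neg_sub, Real.exp_sub, Real.exp_log hσ]; field_simp
  have e1 : ∀ q, axialDensity (fun x y => w y x) σ (Real.log σ - q) *
      hypSq (Real.log σ - q - -a) σ ^ (-β) =
      w (Real.exp q) (σ * Real.exp (-q)) * (σ ^ 2 * Real.exp (-(2 * q)) / hypSq q σ) *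
        hypSq (q - a) σ ^ (-β) := fun q => by
    unfold axialDensity
    rw [hypSq_reflect hσ, show Real.log σ - q - -a = Real.log σ - (q - a) by ring,
      hypSq_reflect hσ, hre, hre',
      show 2 * (Real.log σ - q) = (Real.log σ - q) + (Real.log σ - q) by ring, Real.exp_add, hre,
      show -(2 * q) = -q + -q by ring, Real.exp_add]
    ring_nf
  have i2 := (integrable_axialIntegrand hβ h.swap σ (-a)).comp_sub_left (Real.log σ)
  have i1 := integrable_axialIntegrand hβ h σ a
  unfold flux axialFlux
  rw [← integral_sub_left_eq_self (fun p => axialDensity (fun x y => w y x) σ p *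
      hypSq (p - -a) σ ^ (-β)) volume (Real.log σ), ← integral_add i1 i2,
    ← integral_add_right_eq_self _ (-a)]
  congr 1
  ext p
  rw [e1, neg_add_cancel_right, ← sub_eq_add_neg]
  unfold axialDensity
  rw [← add_mul, ← mul_add, ← add_div]
  have : Real.exp (2 * p) + σ ^ 2 * Real.exp (-(2 * p)) = hypSq p σ := rfl
  rw [this, div_self (hypSq_pos _ _).ne', mul_one]

end

/-! ### The quadrant and its hyperbolic coordinates -/

lemma mem_quadrant {a b : ℝ} : (!₂[a, b] : Plane) ∈ quadrant ↔ 0 ≤ a ∧ 0 ≤ b := Iff.rfl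

lemma plane_eta (x : Plane) : !₂[x 0, x 1] = x := by
  ext i; fin_cases i <;> rfl

lemma plane_norm_sq (x : Plane) : ‖x‖ ^ 2 = x 0 ^ 2 + x 1 ^ 2 := by
  rw [EuclideanSpace.norm_sq_eq, Fin.sum_univ_two, Real.norm_eq_abs, Real.norm_eq_abs, sq_abs,
    sq_abs]

lemma isClosed_quadrant : IsClosed quadrant := by
  have h : ∀ i, IsClosed {x : Plane | 0 ≤ x i} := fun i =>
    isClosed_le continuous_const (by fun_prop)
  exact (h 0).inter (h 1)

lemma convex_quadrant : Convex ℝ quadrant := by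
  intro x hx y hy a b ha hb _
  exact ⟨add_nonneg (mul_nonneg ha hx.1) (mul_nonneg hb hy.1),
    add_nonneg (mul_nonneg ha hx.2) (mul_nonneg hb hy.2)⟩

lemma isOpen_posQuadrant : IsOpen {x : Plane | 0 < x 0 ∧ 0 < x 1} := by
  have h : ∀ i, IsOpen {x : Plane | 0 < x i} := fun i => isOpen_lt continuous_const (by fun_prop)
  exact (h 0).inter (h 1)

lemma uniqueDiffOn_quadrant : UniqueDiffOn ℝ quadrant := by
  refine uniqueDiffOn_convex convex_quadrant ⟨!₂[1, 1], ?_⟩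
  exact mem_interior.2 ⟨_, fun x hx => ⟨hx.1.le, hx.2.le⟩, isOpen_posQuadrant,
    by constructor <;> simp⟩

lemma eqOn_quadrant_of_eqOn_pos {f g : Plane → ℝ} (hf : ContinuousOn f quadrant)
    (hg : ContinuousOn g quadrant) (h : ∀ x : Plane, 0 < x 0 → 0 < x 1 → f x = g x) :
    EqOn f g quadrant := by
  refine EqOn.of_subset_closure (s := {x : Plane | 0 < x 0 ∧ 0 < x 1})
    (fun x hx => h x hx.1 hx.2) hf hg (fun x hx => ⟨hx.1.le, hx.2.le⟩) ?_
  intro x hx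
  have : Tendsto (fun t : ℝ => x + t • (!₂[1, 1] : Plane)) (𝓝[>] 0) (𝓝 x) := by
    refine Tendsto.mono_left ?_ nhdsWithin_le_nhds
    have : Continuous fun t : ℝ => x + t • (!₂[1, 1] : Plane) := by fun_prop
    simpa using this.tendsto 0
  refine mem_closure_of_tendsto this ?_
  filter_upwards [self_mem_nhdsWithin] with t ht
  have ht : 0 < t := ht
  have h0 := hx.1
  have h1 := hx.2
  constructor <;> simp <;> linarith

/-- The point of the hyperbola `y₁ y₂ = σ` with first coordinate `e^p`. -/
noncomputable def hypPoint (σ p : ℝ) : Plane := !₂[Real.exp p, σ * Real.exp (-p)]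

lemma hypPoint_mul (σ p : ℝ) : hypPoint σ p 0 * hypPoint σ p 1 = σ := by
  change Real.exp p * (σ * Real.exp (-p)) = σ
  rw [mul_left_comm, ← Real.exp_add]; simp

lemma hypPoint_mem {σ : ℝ} (hσ : 0 ≤ σ) (p : ℝ) : hypPoint σ p ∈ quadrant :=
  mem_quadrant.2 ⟨(Real.exp_pos _).le, by positivity⟩

lemma norm_hypPoint_sq (σ p : ℝ) : ‖hypPoint σ p‖ ^ 2 = hypSq p σ := by
  rw [plane_norm_sq]; exact exp_sq_add p σ

lemma norm_hypPoint_rpow (σ p r : ℝ) : ‖hypPoint σ p‖ ^ (2 * r) = hypSq p σ ^ r := by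
  rw [← norm_hypPoint_sq, Real.rpow_mul (norm_nonneg _), Real.rpow_two]

/-- The area-preserving map that moves each hyperbola `x₁ x₂ = σ` along itself by the hyperbolic
rotation of parameter `a σ`. -/
noncomputable def shear (a : ℝ → ℝ) (x : Plane) : Plane :=
  !₂[x 0 * Real.exp (a (x 0 * x 1)), x 1 * Real.exp (-a (x 0 * x 1))]

lemma shear_hypPoint (a : ℝ → ℝ) (σ p : ℝ) : shear a (hypPoint σ p) = hypPoint σ (p + a σ) := by
  rw [shear, hypPoint_mul]
  simp only [hypPoint, neg_add, Real.exp_add]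
  ext i
  fin_cases i
  · rfl
  · exact mul_assoc _ _ _

lemma shear_mem (a : ℝ → ℝ) {x : Plane} (hx : x ∈ quadrant) : shear a x ∈ quadrant :=
  mem_quadrant.2 ⟨mul_nonneg hx.1 (Real.exp_pos _).le, mul_nonneg hx.2 (Real.exp_pos _).le⟩

lemma shear_mul (a : ℝ → ℝ) (x : Plane) : shear a x 0 * shear a x 1 = x 0 * x 1 := by
  change x 0 * Real.exp (a (x 0 * x 1)) * (x 1 * Real.exp (-a (x 0 * x 1))) = x 0 * x 1
  rw [Real.exp_neg]; field_simp

lemma shear_shear (a b : ℝ → ℝ) (x : Plane) : shear a (shear b x) = shear (a + b) x := by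
  rw [shear, shear_mul]
  simp only [shear, Pi.add_apply, neg_add, Real.exp_add]
  ext i
  fin_cases i
  · change x 0 * _ * _ = x 0 * _
    ring
  · change x 1 * _ * _ = x 1 * _
    ring

lemma shear_zero (x : Plane) : shear 0 x = x := by
  simp [shear, plane_eta]

lemma norm_shear_le {a : ℝ → ℝ} {x : Plane} {r : ℝ} (h : |a (x 0 * x 1)| ≤ r) :
    ‖shear a x‖ ≤ Real.exp r * ‖x‖ := by
  obtain ⟨h1, h2⟩ := abs_le.1 h
  refine le_of_sq_le_sq ?_ (by positivity)
  rw [mul_pow, plane_norm_sq, plane_norm_sq]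
  change (x 0 * Real.exp (a (x 0 * x 1))) ^ 2 + (x 1 * Real.exp (-a (x 0 * x 1))) ^ 2 ≤ _
  have e1 : Real.exp (a (x 0 * x 1)) ^ 2 ≤ Real.exp r ^ 2 := by gcongr
  have e2 : Real.exp (-a (x 0 * x 1)) ^ 2 ≤ Real.exp r ^ 2 := by gcongr; linarith
  nlinarith [mul_le_mul_of_nonneg_left e1 (sq_nonneg (x 0)),
    mul_le_mul_of_nonneg_left e2 (sq_nonneg (x 1))]

lemma le_norm_shear {a : ℝ → ℝ} {x : Plane} {r : ℝ} (h : |a (x 0 * x 1)| ≤ r) :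
    ‖x‖ ≤ Real.exp r * ‖shear a x‖ := by
  have := norm_shear_le (a := -a) (x := shear a x) (r := r) (by
    rw [shear_mul, Pi.neg_apply, abs_neg]; exact h)
  rwa [shear_shear, neg_add_cancel, shear_zero] at this

/-! ### Integration in hyperbolic coordinates -/

/-- The derivative of `(σ, p) ↦ (e^p, σ e^{-p})`. Its determinant is `-1`. -/
noncomputable def hypDeriv (z : ℝ × ℝ) : ℝ × ℝ →L[ℝ] ℝ × ℝ :=
  (Matrix.toLin (.finTwoProd ℝ) (.finTwoProd ℝ)
    !![0, Real.exp z.2; Real.exp (-z.2), -(z.1 * Real.exp (-z.2))]).toContinuousLinearMap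

lemma hasFDerivAt_hyp (z : ℝ × ℝ) :
    HasFDerivAt (fun z : ℝ × ℝ => (Real.exp z.2, z.1 * Real.exp (-z.2))) (hypDeriv z) z := by
  unfold hypDeriv
  rw [Matrix.toLin_finTwoProd_toContinuousLinearMap]
  have h2 : HasFDerivAt (fun z : ℝ × ℝ => z.2) (ContinuousLinearMap.snd ℝ ℝ ℝ) z := hasFDerivAt_snd
  refine ((h2.exp).prodMk (hasFDerivAt_fst.mul h2.neg.exp)).congr_fderiv ?_
  ext <;> simp

lemma abs_det_hypDeriv (z : ℝ × ℝ) : |(hypDeriv z).det| = 1 := by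
  unfold hypDeriv
  simp only [LinearMap.det_toContinuousLinearMap, LinearMap.det_toLin, Matrix.det_fin_two_of]
  rw [zero_mul, ← Real.exp_add]; simp

lemma injective_hyp : Function.Injective fun z : ℝ × ℝ => (Real.exp z.2, z.1 * Real.exp (-z.2)) := by
  rintro ⟨σ, p⟩ ⟨τ, q⟩ h
  simp only [Prod.mk.injEq, Real.exp_eq_exp] at h
  obtain ⟨rfl, h2⟩ := h
  rw [mul_left_inj' (Real.exp_pos _).ne'] at h2
  rw [h2]

lemma image_hyp (s : ℝ) : (fun z : ℝ × ℝ => (Real.exp z.2, z.1 * Real.exp (-z.2))) ''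
    (Ici s ×ˢ univ) = {z | 0 < z.1 ∧ s ≤ z.1 * z.2} := by
  ext ⟨a, b⟩
  simp only [mem_image, mem_prod, mem_Ici, mem_univ, and_true, Prod.exists, Prod.mk.injEq,
    mem_ofPred_eq]
  constructor
  · rintro ⟨σ, p, h, rfl, rfl⟩
    refine ⟨Real.exp_pos _, h.trans_eq ?_⟩
    rw [mul_left_comm, ← Real.exp_add]; simp
  · rintro ⟨ha, h⟩
    refine ⟨a * b, Real.log a, h, Real.exp_log ha, ?_⟩
    rw [Real.exp_neg, Real.exp_log ha]; field_simp

lemma measurePreserving_toPlane :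
    MeasurePreserving (fun z : ℝ × ℝ => (!₂[z.1, z.2] : Plane)) ∧
      MeasurableEmbedding (fun z : ℝ × ℝ => (!₂[z.1, z.2] : Plane)) := by
  have h := (PiLp.volume_preserving_toLp (Fin 2)).comp (volume_preserving_finTwoArrow ℝ).symm
  have e := ((MeasurableEquiv.toLp 2 (Fin 2 → ℝ)).measurableEmbedding).comp
    (MeasurableEquiv.finTwoArrow (α := ℝ)).symm.measurableEmbedding
  exact ⟨h, e⟩

/-- The hyperbolic coordinates miss the `y₂`-axis, which is a null set. -/
lemma preimage_region_ae_eq {x : Plane} (hx : 0 ≤ x 0 * x 1) :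
    ((fun z : ℝ × ℝ => (!₂[z.1, z.2] : Plane)) ⁻¹' region x : Set (ℝ × ℝ)) =ᵐ[volume]
      {z | 0 < z.1 ∧ x 0 * x 1 ≤ z.1 * z.2} := by
  have hnull : ∀ᵐ z : ℝ × ℝ, z.1 ≠ 0 := by
    have : (volume : Measure (ℝ × ℝ)) ({0} ×ˢ univ) = 0 := by
      rw [Measure.volume_eq_prod, Measure.prod_prod]; simp
    refine measure_mono_null ?_ this
    intro z hz
    simpa using hz
  filter_upwards [hnull] with z hz
  refine propext ?_
  change ((0 ≤ z.1 ∧ 0 ≤ z.2) ∧ x 0 * x 1 ≤ z.1 * z.2) ↔ (0 < z.1 ∧ x 0 * x 1 ≤ z.1 * z.2)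
  constructor
  · rintro ⟨⟨h1, -⟩, h2⟩
    exact ⟨lt_of_le_of_ne h1 hz.symm, h2⟩
  · rintro ⟨h1, h2⟩
    exact ⟨⟨h1.le, nonneg_of_mul_nonneg_right (hx.trans h2) h1⟩, h2⟩

lemma prod_Ici_ae_eq (s : ℝ) :
    (Ici s ×ˢ univ : Set (ℝ × ℝ)) =ᵐ[volume] (Ioi s ×ˢ univ : Set (ℝ × ℝ)) :=
  Measure.set_prod_ae_eq Ioi_ae_eq_Ici.symm (ae_eq_refl _)

lemma integrableOn_region_iff (f : Plane → ℝ) {x : Plane} (hx : 0 ≤ x 0 * x 1) :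
    IntegrableOn f (region x) ↔
      IntegrableOn (fun z : ℝ × ℝ => f (hypPoint z.1 z.2)) (Ioi (x 0 * x 1) ×ˢ univ) := by
  rw [← measurePreserving_toPlane.1.integrableOn_comp_preimage measurePreserving_toPlane.2,
    integrableOn_congr_set_ae (preimage_region_ae_eq hx), ← image_hyp,
    integrableOn_image_iff_integrableOn_abs_det_fderiv_smul volume
      (measurableSet_Ici.prod MeasurableSet.univ)
      (fun z _ => (hasFDerivAt_hyp z).hasFDerivWithinAt) injective_hyp.injOn,
    integrableOn_congr_set_ae (prod_Ici_ae_eq _)]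
  simp only [abs_det_hypDeriv, one_smul]
  rfl

lemma integral_region (f : Plane → ℝ) {x : Plane} (hx : 0 ≤ x 0 * x 1) :
    ∫ y in region x, f y =
      ∫ z in Ioi (x 0 * x 1) ×ˢ univ, f (hypPoint z.1 z.2) := by
  rw [← measurePreserving_toPlane.1.setIntegral_preimage_emb measurePreserving_toPlane.2,
    setIntegral_congr_set (preimage_region_ae_eq hx), ← image_hyp,
    integral_image_eq_integral_abs_det_fderiv_smul volume
      (measurableSet_Ici.prod MeasurableSet.univ)
      (fun z _ => (hasFDerivAt_hyp z).hasFDerivWithinAt) injective_hyp.injOn,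
    setIntegral_congr_set (prod_Ici_ae_eq _)]
  simp only [abs_det_hypDeriv, one_smul]
  rfl

/-! ### The velocity of a sheared vorticity -/

/-- The initial vorticity as a function of the coordinates, extended from the quadrant to all of
`ℝ²` by projecting onto the quadrant. -/
noncomputable def quadrantProfile (f : Plane → ℝ) (a b : ℝ) : ℝ := f !₂[max a 0, max b 0]

lemma quadrantProfile_hypPoint (f : Plane → ℝ) {σ : ℝ} (hσ : 0 ≤ σ) (p : ℝ) :
    quadrantProfile f (Real.exp p) (σ * Real.exp (-p)) = f (hypPoint σ p) := by
  rw [quadrantProfile, max_eq_left (Real.exp_pos _).le, max_eq_left (mul_nonneg hσ (Real.exp_pos _).le)]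
  rfl

lemma IsC10.continuousOn {f : Plane → ℝ} (hf : IsC10 f) : ContinuousOn f quadrant :=
  hf.1.continuousOn

lemma mem_quadrantSupport {f : Plane → ℝ} {x : Plane} (hx : x ∈ quadrant) (h : f x ≠ 0) :
    x ∈ quadrantSupport f := subset_closure ⟨hx, h⟩

lemma quadrantSupport_subset (f : Plane → ℝ) : quadrantSupport f ⊆ quadrant :=
  closure_minimal (fun _ hx => hx.1) isClosed_quadrant

lemma IsC10.exists_bound {f : Plane → ℝ} (hf : IsC10 f) : ∃ C, ∀ x ∈ quadrant, |f x| ≤ C := by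
  obtain ⟨C, hC⟩ := hf.2.exists_bound_of_continuousOn
    (hf.continuousOn.mono (quadrantSupport_subset f))
  refine ⟨max C 0, fun x hx => ?_⟩
  by_cases h : f x = 0
  · simp [h]
  · exact (hC x (mem_quadrantSupport hx h)).trans (le_max_left _ _)

lemma IsC10.exists_isProfile {f : Plane → ℝ} (hf : IsC10 f) (h0 : (0 : Plane) ∉ quadrantSupport f) :
    ∃ δ M C, IsProfile (quadrantProfile f) δ M C := by
  obtain ⟨C, hC⟩ := hf.exists_bound
  obtain ⟨M, hM0, hM⟩ := hf.2.isBounded.exists_pos_norm_le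
  obtain ⟨δ, hδ0, hδ⟩ := Metric.isOpen_iff.1 isClosed_closure.isOpen_compl 0 h0
  have hmem : ∀ a b : ℝ, (!₂[max a 0, max b 0] : Plane) ∈ quadrant := fun a b =>
    mem_quadrant.2 ⟨le_max_right _ _, le_max_right _ _⟩
  have hup : ∀ a b : ℝ, quadrantProfile f a b ≠ 0 → max a 0 ^ 2 + max b 0 ^ 2 ≤ M ^ 2 := by
    intro a b h
    have := hM _ (mem_quadrantSupport (hmem a b) h)
    have h2 := plane_norm_sq !₂[max a 0, max b 0]
    change _ = max a 0 ^ 2 + max b 0 ^ 2 at h2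
    rw [← h2]; gcongr
  refine ⟨δ, M, C, hδ0, hM0, ?_, fun a b => hC _ (hmem a b), ?_, ?_, ?_⟩
  · exact hf.continuousOn.comp_continuous
      (f := fun z : ℝ × ℝ => (!₂[max z.1 0, max z.2 0] : Plane)) (by fun_prop)
      fun z => hmem z.1 z.2
  · intro a b h
    have h1 : δ ≤ ‖(!₂[max a 0, max b 0] : Plane)‖ := by
      by_contra hlt
      exact hδ (by simpa using hlt) (mem_quadrantSupport (hmem a b) h)
    have h2 := plane_norm_sq !₂[max a 0, max b 0]
    change _ = max a 0 ^ 2 + max b 0 ^ 2 at h2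
    have h3 : δ ^ 2 ≤ max a 0 ^ 2 + max b 0 ^ 2 := by rw [← h2]; gcongr
    have h4 : ∀ c : ℝ, max c 0 ^ 2 ≤ c ^ 2 := fun c => by
      rcases le_total c 0 with hc | hc
      · rw [max_eq_right hc]; nlinarith [sq_nonneg c]
      · rw [max_eq_left hc]
    linarith [h4 a, h4 b]
  · intro a b h
    refine (le_max_left a 0).trans (le_of_sq_le_sq ?_ hM0.le)
    nlinarith [hup a b h]
  · intro a b h
    refine (le_max_left b 0).trans (le_of_sq_le_sq ?_ hM0.le)
    nlinarith [hup a b h]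

lemma quadrantProfile_apply (f : Plane → ℝ) {x : Plane} (hx : x ∈ quadrant) :
    quadrantProfile f (x 0) (x 1) = f x := by
  rw [quadrantProfile, max_eq_left hx.1, max_eq_left hx.2, plane_eta]

section

variable {α : ℝ} {ω₀ : Plane → ℝ} {δ M C : ℝ}

lemma integral_shear_hypPoint (hα : 0 ≤ α) (h : IsProfile (quadrantProfile ω₀) δ M C)
    {f : Plane → ℝ} {a : ℝ → ℝ} (hf : ∀ x : Plane, 0 < x 0 → 0 < x 1 → f x = ω₀ (shear a x))
    {σ : ℝ} (hσ : 0 < σ) :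
    ∫ p, bsIntegrand α f (hypPoint σ p) = flux (1 + α / 2) (quadrantProfile ω₀) σ (a σ) := by
  rw [← integral_shift_eq_flux (by positivity) h hσ]
  congr 1
  ext p
  rw [bsIntegrand, hf _ (Real.exp_pos p) (mul_pos hσ (Real.exp_pos _)), shear_hypPoint,
    quadrantProfile_hypPoint _ hσ.le, show 2 + α = 2 * (1 + α / 2) by ring, norm_hypPoint_rpow,
    Real.rpow_neg (hypSq_pos _ _).le, div_eq_mul_inv]

/-- The Biot–Savart law for a vorticity that is a sheared copy of `ω₀`: only the shear on the
hyperbolas `y₁ y₂ = σ` beyond the one of `x` enters. -/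
lemma bigOmega_eq_integral_flux (hα : 0 ≤ α) (h : IsProfile (quadrantProfile ω₀) δ M C)
    {f : Plane → ℝ} {a : ℝ → ℝ} (hf : ∀ x : Plane, 0 < x 0 → 0 < x 1 → f x = ω₀ (shear a x))
    {x : Plane} (hx : x ∈ quadrant) (hint : IntegrableOn (bsIntegrand α f) (region x)) :
    IntegrableOn (fun σ => flux (1 + α / 2) (quadrantProfile ω₀) σ (a σ)) (Ioi (x 0 * x 1)) ∧
    bigOmega α f x = ∫ σ in Ioi (x 0 * x 1), flux (1 + α / 2) (quadrantProfile ω₀) σ (a σ) := by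
  have hs : 0 ≤ x 0 * x 1 := mul_nonneg hx.1 hx.2
  rw [integrableOn_region_iff _ hs] at hint
  have hint' := hint
  rw [IntegrableOn, Measure.volume_eq_prod, ← Measure.prod_restrict, Measure.restrict_univ] at hint'
  have key : ∀ σ ∈ Ioi (x 0 * x 1), ∫ p, bsIntegrand α f (hypPoint σ p) =
      flux (1 + α / 2) (quadrantProfile ω₀) σ (a σ) :=
    fun σ hσ => integral_shear_hypPoint hα h hf (hs.trans_lt hσ)
  constructor
  · exact IntegrableOn.congr_fun hint'.integral_prod_left key measurableSet_Ioi
  · rw [bigOmega, integral_region _ hs, Measure.volume_eq_prod, setIntegral_prod _ hint]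
    refine setIntegral_congr_fun measurableSet_Ioi fun σ hσ => ?_
    simp only [Measure.restrict_univ]
    exact key σ hσ

end

/-! ### The evolution equation of the shear -/

/-- The Picard–Lindelöf theorem with the information that the solution stays in the ball on which
the vector field is Lipschitz. -/
lemma exists_solution_mem_closedBall {E : Type*} [NormedAddCommGroup E] [NormedSpace ℝ E]
    [CompleteSpace E] {f : E → E} {a K : NNReal} (ha : 0 < a)
    (hf : LipschitzOnWith K f (Metric.closedBall 0 a)) :
    ∃ T : ℝ, 0 < T ∧ ∃ b : ℝ → E, Continuous b ∧ b 0 = 0 ∧ (∀ t, ‖b t‖ ≤ a) ∧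
      ∀ t ∈ Icc 0 T, HasDerivWithinAt b (f (b t)) (Icc 0 T) t := by
  set L : NNReal := ‖f 0‖₊ + K * a + 1 with hL
  have hL0 : 0 < (L : ℝ) := by rw [hL]; positivity
  have hT : (0 : ℝ) < a / L := div_pos (by exact_mod_cast ha) hL0
  let t₀ : Icc (0 : ℝ) (a / L) := ⟨0, le_rfl, hT.le⟩
  have hpl : IsPicardLindelof (fun _ : ℝ => f) t₀ 0 a 0 L K := by
    refine .of_time_independent (fun x hx => ?_) hf ?_
    · have h1 := hf.dist_le_mul x hx 0 (Metric.mem_closedBall_self a.2)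
      rw [dist_eq_norm] at h1
      have h2 : (K : ℝ) * dist x 0 ≤ K * a := by gcongr; exact hx
      have h3 := norm_le_norm_add_norm_sub' (f x) (f 0)
      rw [hL]; push_cast
      linarith
    · change (L : ℝ) * max ((a : ℝ) / L - 0) ((0 : ℝ) - 0) ≤ a - (0 : NNReal)
      rw [sub_zero, sub_zero, max_eq_left hT.le, mul_div_cancel₀ _ hL0.ne']
      simp
  have h0 : (0 : E) ∈ Metric.closedBall (0 : E) (0 : NNReal) := by simp
  obtain ⟨b, hb⟩ := ODE.FunSpace.exists_isFixedPt_next hpl h0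
  refine ⟨a / L, hT, b.compProj, b.continuous_compProj, ?_, fun t => ?_, fun t ht => ?_⟩
  · change b.compProj t₀ = 0
    rw [ODE.FunSpace.compProj_val, ODE.FunSpace.apply_of_zero]
  · simpa using b.compProj_mem_closedBall hpl.mul_max_le (t := t)
  · refine (ODE.hasDerivWithinAt_picard_Icc t₀.2 hpl.continuousOn_uncurry
      b.continuous_compProj.continuousOn
      (fun _ _ => b.compProj_mem_closedBall hpl.mul_max_le) 0 ht).congr_of_mem ?_ ht
    intro s hs
    rw [ODE.FunSpace.compProj_of_mem hs, (ODE.FunSpace.isFixedPt_next_iff hpl h0).1 hb]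

section

variable {S : ℝ} (hS : 0 ≤ S)

/-- The integral `∫_s^S b`, for a continuous function `b` on `[0, S]` extended by constants. -/
noncomputable def tail (s : ℝ) : C(Icc 0 S, ℝ) →L[ℝ] ℝ :=
  LinearMap.mkContinuous
    { toFun := fun b => ∫ σ in s..S, IccExtend hS b σ
      map_add' := fun b c => by
        rw [← intervalIntegral.integral_add (b.continuous.Icc_extend'.intervalIntegrable _ _)
          (c.continuous.Icc_extend'.intervalIntegrable _ _)]
        rfl
      map_smul' := fun r b => by
        rw [RingHom.id_apply, smul_eq_mul, ← intervalIntegral.integral_const_mul]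
        rfl } |S - s| fun b => by
    rw [mul_comm]
    exact intervalIntegral.norm_integral_le_of_norm_le_const fun σ _ => b.norm_coe_le_norm _

lemma tail_apply (s : ℝ) (b : C(Icc 0 S, ℝ)) : tail hS s b = ∫ σ in s..S, IccExtend hS b σ := rfl

lemma abs_tail_le (s : ℝ) (b : C(Icc 0 S, ℝ)) : |tail hS s b| ≤ |S - s| * ‖b‖ := by
  rw [tail_apply, mul_comm]
  exact intervalIntegral.norm_integral_le_of_norm_le_const fun σ _ => b.norm_coe_le_norm _

lemma continuous_extend_uncurry {b : ℝ → C(Icc 0 S, ℝ)} (hb : Continuous b) :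
    Continuous fun z : ℝ × ℝ => IccExtend hS (b z.1) z.2 := by
  unfold IccExtend
  exact (hb.comp continuous_fst).eval (continuous_projIcc.comp continuous_snd)

lemma continuous_tail_uncurry {b : ℝ → C(Icc 0 S, ℝ)} (hb : Continuous b) :
    Continuous fun z : ℝ × ℝ => tail hS z.2 (b z.1) := by
  have h := intervalIntegral.continuous_parametric_intervalIntegral_of_continuous
    (μ := volume) (f := fun (z : ℝ × ℝ) σ => IccExtend hS (b z.1) σ) (a₀ := S) (s := Prod.snd)
    ((continuous_extend_uncurry hS hb).comp
      (f := fun z : (ℝ × ℝ) × ℝ => (z.1.1, z.2)) (by fun_prop)) continuous_snd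
  refine h.neg.congr fun z => ?_
  rw [tail_apply, intervalIntegral.integral_symm]
  rfl

lemma hasDerivAt_tail (b : C(Icc 0 S, ℝ)) (s : ℝ) :
    HasDerivAt (fun s => tail hS s b) (-IccExtend hS b s) s :=
  intervalIntegral.integral_hasDerivAt_left (b.continuous.Icc_extend'.intervalIntegrable _ _)
    b.continuous.Icc_extend'.aestronglyMeasurable.stronglyMeasurableAtFilter
    b.continuous.Icc_extend'.continuousAt

end

/-- Local solvability of `∂ₜ A(t, s) = ∫_s^∞ G(σ, A(t, σ)) dσ`, `A(0, ·) = 0`, for a function `G`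
that is Lipschitz in its second variable and vanishes for `σ ≥ S`. The unknown of the
Picard–Lindelöf theorem is `B = -∂ₛ A`, which makes `A` continuously differentiable in `s`. -/
theorem exists_shear_path {G : ℝ → ℝ → ℝ} {S L : ℝ} (hS : 0 < S) (hL : 0 ≤ L)
    (hG : Continuous fun z : ℝ × ℝ => G z.1 z.2) (hG0 : ∀ σ a, S ≤ σ → G σ a = 0)
    (hlip : ∀ σ a b, |a| ≤ 1 → |b| ≤ 1 → |G σ a - G σ b| ≤ L * |a - b|) :
    ∃ T : ℝ, 0 < T ∧ ∃ A B : ℝ → ℝ → ℝ,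
      Continuous (fun z : ℝ × ℝ => A z.1 z.2) ∧ Continuous (fun z : ℝ × ℝ => B z.1 z.2) ∧
      (∀ t s, HasDerivAt (A t) (-B t s) s) ∧ A 0 = 0 ∧
      (∀ t, ∀ s ∈ Icc 0 S, |A t s| ≤ 1) ∧
      ∀ t ∈ Icc 0 T, ∀ s, 0 ≤ s →
        HasDerivWithinAt (fun τ => A τ s) (∫ σ in Ioi s, G σ (A t σ)) (Icc 0 T) t := by
  have hcont : ∀ b : C(Icc 0 S, ℝ), Continuous fun s => tail hS.le s b := fun b =>
    continuous_iff_continuousAt.2 fun s => (hasDerivAt_tail hS.le b s).continuousAt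
  let F : C(Icc 0 S, ℝ) → C(Icc 0 S, ℝ) := fun b =>
    ⟨fun σ => G σ (tail hS.le σ b), hG.comp (f := fun σ : Icc 0 S => ((σ : ℝ), tail hS.le σ b))
      (continuous_subtype_val.prodMk ((hcont b).comp continuous_subtype_val))⟩
  have htail : ∀ b : C(Icc 0 S, ℝ), ∀ s ∈ Icc 0 S, |tail hS.le s b| ≤ S * ‖b‖ := fun b s hs => by
    refine (abs_tail_le hS.le s b).trans ?_
    gcongr
    rw [abs_of_nonneg (sub_nonneg.2 hs.2)]
    linarith [hs.1]
  have hball : ∀ b : C(Icc 0 S, ℝ), ‖b‖ ≤ S⁻¹ → ∀ s ∈ Icc 0 S, |tail hS.le s b| ≤ 1 :=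
    fun b hb s hs => (htail b s hs).trans (by
      rw [← mul_inv_cancel₀ hS.ne']; gcongr)
  have hF : LipschitzOnWith (L * S).toNNReal F (Metric.closedBall 0 (S⁻¹).toNNReal) := by
    refine LipschitzOnWith.of_dist_le_mul fun b hb c hc => ?_
    rw [mem_closedBall_zero_iff, Real.coe_toNNReal _ (inv_nonneg.2 hS.le)] at hb hc
    rw [dist_eq_norm, dist_eq_norm, Real.coe_toNNReal _ (by positivity),
      ContinuousMap.norm_le _ (by positivity)]
    intro σ
    calc |G σ (tail hS.le σ b) - G σ (tail hS.le σ c)|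
        ≤ L * |tail hS.le σ b - tail hS.le σ c| := hlip _ _ _ (hball b hb σ σ.2) (hball c hc σ σ.2)
      _ = L * |tail hS.le σ (b - c)| := by rw [map_sub]
      _ ≤ L * (S * ‖b - c‖) := by gcongr; exact htail _ _ σ.2
      _ = _ := by ring
  obtain ⟨T, hT, b, hbc, hb0, hbn, hbd⟩ := exists_solution_mem_closedBall
    (Real.toNNReal_pos.2 (inv_pos.2 hS)) hF
  rw [Real.coe_toNNReal _ (inv_nonneg.2 hS.le)] at hbn
  refine ⟨T, hT, fun t s => tail hS.le s (b t), fun t => IccExtend hS.le (b t),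
    continuous_tail_uncurry hS.le hbc, continuous_extend_uncurry hS.le hbc,
    fun t s => hasDerivAt_tail hS.le (b t) s, ?_, fun t => hball _ (hbn t), fun t ht s hs => ?_⟩
  · ext s
    simp [hb0]
  · have h := (tail hS.le s).hasFDerivAt.comp_hasDerivWithinAt t (hbd t ht)
    refine h.congr_deriv ?_
    have hext : ∀ σ, 0 ≤ σ → IccExtend hS.le (F (b t)) σ = G σ (tail hS.le σ (b t)) := by
      intro σ hσ
      rcases le_total σ S with hle | hle
      · rw [IccExtend_of_mem _ _ ⟨hσ, hle⟩]; rfl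
      · rw [IccExtend_of_right_le _ _ hle, hG0 _ _ hle]
        exact hG0 _ _ le_rfl
    rw [tail_apply]
    rcases le_total s S with hle | hle
    · rw [intervalIntegral.integral_of_le hle, setIntegral_congr_fun measurableSet_Ioc
        fun σ hσ => hext σ (hs.trans hσ.1.le)]
      refine (setIntegral_eq_of_subset_of_forall_sdiff_eq_zero measurableSet_Ioi
        Ioc_subset_Ioi_self fun σ hσ => hG0 _ _ ?_).symm
      by_contra hlt
      exact hσ.2 ⟨hσ.1, (not_le.1 hlt).le⟩
    · rw [intervalIntegral.integral_symm, intervalIntegral.integral_of_le hle,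
        setIntegral_eq_zero_of_forall_eq_zero (t := Ioc S s), neg_zero,
        setIntegral_eq_zero_of_forall_eq_zero]
      · exact fun σ hσ => hG0 _ _ (hle.trans (mem_Ioi.1 hσ).le)
      · exact fun σ hσ => by rw [hext σ (hS.le.trans hσ.1.le), hG0 _ _ hσ.1.le]

/-! ### Construction of a solution -/

/-- The derivative of `shear a` at `x`, where `a'` is the derivative of `a`. -/
noncomputable def shearDeriv (a a' : ℝ → ℝ) (x : Plane) : Plane →L[ℝ] Plane :=
  (Real.exp (a (x 0 * x 1)) • (EuclideanSpace.proj 0 + (x 0 * a' (x 0 * x 1)) •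
    (x 0 • EuclideanSpace.proj 1 + x 1 • EuclideanSpace.proj 0) : Plane →L[ℝ] ℝ)).smulRight
      (!₂[1, 0] : Plane) +
  (Real.exp (-a (x 0 * x 1)) • (EuclideanSpace.proj 1 - (x 1 * a' (x 0 * x 1)) •
    (x 0 • EuclideanSpace.proj 1 + x 1 • EuclideanSpace.proj 0) : Plane →L[ℝ] ℝ)).smulRight
      (!₂[0, 1] : Plane)

lemma plane_eq_smul_add_smul (a b : ℝ) : (!₂[a, b] : Plane) = a • !₂[1, 0] + b • !₂[0, 1] := by
  ext i; fin_cases i <;> simp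

lemma hasFDerivAt_shear {a a' : ℝ → ℝ} (ha : ∀ s, HasDerivAt a (a' s) s) (x : Plane) :
    HasFDerivAt (shear a) (shearDeriv a a' x) x := by
  have hc : ∀ i, HasFDerivAt (fun y : Plane => y i) (EuclideanSpace.proj i : Plane →L[ℝ] ℝ) x :=
    fun i => (EuclideanSpace.proj i : Plane →L[ℝ] ℝ).hasFDerivAt
  have hm := (ha (x 0 * x 1)).comp_hasFDerivAt x ((hc 0).mul (hc 1))
  have h0 := ((hc 0).mul hm.exp).smul_const (!₂[1, 0] : Plane)
  have h1 := ((hc 1).mul hm.neg.exp).smul_const (!₂[0, 1] : Plane)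
  have h := h0.add h1
  have e : shear a = (fun y : Plane => (y 0 * Real.exp ((a ∘ fun y : Plane => y 0 * y 1) y)) •
      (!₂[1, 0] : Plane)) + fun y : Plane =>
      (y 1 * Real.exp ((-(a ∘ fun y : Plane => y 0 * y 1)) y)) • (!₂[0, 1] : Plane) := by
    ext1 y
    exact plane_eq_smul_add_smul _ _
  rw [e]
  refine h.congr_fderiv ?_
  unfold shearDeriv
  congr 2
  · ext v
    simp
    ring
  · ext v
    simp
    ring

lemma continuous_shearDeriv {A B : ℝ → ℝ → ℝ} (hA : Continuous fun z : ℝ × ℝ => A z.1 z.2)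
    (hB : Continuous fun z : ℝ × ℝ => B z.1 z.2) :
    Continuous fun z : ℝ × Plane => shearDeriv (A z.1) (B z.1) z.2 := by
  have hA' : Continuous fun z : ℝ × Plane => A z.1 (z.2 0 * z.2 1) :=
    hA.comp (f := fun z : ℝ × Plane => (z.1, z.2 0 * z.2 1)) (by fun_prop)
  have hB' : Continuous fun z : ℝ × Plane => B z.1 (z.2 0 * z.2 1) :=
    hB.comp (f := fun z : ℝ × Plane => (z.1, z.2 0 * z.2 1)) (by fun_prop)
  have hr : ∀ e : Plane, Continuous fun l : Plane →L[ℝ] ℝ => l.smulRight e := fun e =>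
    ((ContinuousLinearMap.smulRightL ℝ Plane Plane).flip e).continuous
  unfold shearDeriv
  exact ((hr _).comp (by fun_prop)).add ((hr _).comp (by fun_prop))

lemma continuous_shear_uncurry {A : ℝ → ℝ → ℝ} (hA : Continuous fun z : ℝ × ℝ => A z.1 z.2) :
    Continuous fun z : ℝ × Plane => shear (A z.1) z.2 := by
  have hA' : Continuous fun z : ℝ × Plane => A z.1 (z.2 0 * z.2 1) :=
    hA.comp (f := fun z : ℝ × Plane => (z.1, z.2 0 * z.2 1)) (by fun_prop)
  unfold shear
  fun_prop

lemma contDiff_shear {a a' : ℝ → ℝ} (ha : ∀ s, HasDerivAt a (a' s) s) (ha' : Continuous a') :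
    ContDiff ℝ 1 (shear a) := by
  rw [contDiff_one_iff_hasFDerivAt]
  have hac : Continuous a := continuous_iff_continuousAt.2 fun s => (ha s).continuousAt
  exact ⟨shearDeriv a a', (continuous_shearDeriv (A := fun _ => a) (B := fun _ => a')
    (hac.comp continuous_snd) (ha'.comp continuous_snd)).comp
    (f := fun x : Plane => ((0 : ℝ), x)) (by fun_prop), hasFDerivAt_shear ha⟩

lemma hasDerivWithinAt_shear {A : ℝ → ℝ → ℝ} {I : Set ℝ} {t v : ℝ} {x : Plane}
    (h : HasDerivWithinAt (fun τ => A τ (x 0 * x 1)) v I t) :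
    HasDerivWithinAt (fun τ => shear (A τ) x)
      (!₂[shear (A t) x 0 * v, -(shear (A t) x 1 * v)]) I t := by
  have h0 := (h.exp.const_mul (x 0)).smul_const (!₂[1, 0] : Plane)
  have h1 := (h.neg.exp.const_mul (x 1)).smul_const (!₂[0, 1] : Plane)
  have h := h0.add h1
  have e : (fun τ => shear (A τ) x) = (fun τ => (x 0 * Real.exp (A τ (x 0 * x 1))) •
      (!₂[1, 0] : Plane)) + fun τ =>
      (x 1 * Real.exp ((-fun τ => A τ (x 0 * x 1)) τ)) • (!₂[0, 1] : Plane) := by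
    ext1 τ
    exact plane_eq_smul_add_smul _ _
  rw [e]
  refine h.congr_deriv ?_
  rw [plane_eq_smul_add_smul (_ * v)]
  simp [shear, mul_assoc]

/-- The velocity is tangent to the hyperbolas `x₁ x₂ = σ`, along which `shear a` is a hyperbolic
rotation; so only the values of `a`, not its derivative, enter here. -/
lemma shearDeriv_velocity (a a' : ℝ → ℝ) (α : ℝ) (f : Plane → ℝ) (x : Plane) :
    shearDeriv a a' x (velocity α f x) =
      -!₂[shear a x 0 * bigOmega α f x, -(shear a x 1 * bigOmega α f x)] := by
  ext i
  fin_cases i <;> simp [shearDeriv, velocity, shear] <;> ring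

/-- A family of functions that is jointly continuous and supported in a fixed compact set depends
continuously on the parameter for the uniform norm. -/
lemma tendstoUniformlyOn_of_isCompact {X F : Type*} [TopologicalSpace X] [NormedAddCommGroup F]
    {f : ℝ → X → F} {I : Set ℝ} {Q K : Set X} (hK : IsCompact (Q ∩ K))
    (hf : ContinuousOn (fun z : ℝ × X => f z.1 z.2) (I ×ˢ Q))
    (h0 : ∀ t ∈ I, ∀ x ∈ Q, x ∉ K → f t x = 0) {t : ℝ} (ht : t ∈ I) :
    TendstoUniformlyOn f (f t) (𝓝[I] t) Q := by
  intro u hu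
  obtain ⟨v, hv, H⟩ := hK.mem_uniformity_of_prod
    (hf.mono (prod_mono_right inter_subset_left)) ht (symm_le_uniformity hu)
  filter_upwards [hv, self_mem_nhdsWithin] with s hs hsI x hx
  by_cases hxK : x ∈ K
  · exact H s hs x ⟨hx, hxK⟩
  · rw [h0 s hsI x hx hxK, h0 t ht x hx hxK]
    exact refl_mem_uniformity hu

section

variable {α : ℝ} {ω₀ : Plane → ℝ} {δ M C : ℝ}

lemma norm_bounds_of_shear_ne_zero (h : IsProfile (quadrantProfile ω₀) δ M C) {a : ℝ → ℝ}
    (ha : ∀ s ∈ Icc 0 (M ^ 2 + 1), |a s| ≤ 1) {x : Plane} (hx : x ∈ quadrant)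
    (hne : ω₀ (shear a x) ≠ 0) :
    δ / Real.exp 1 ≤ ‖x‖ ∧ ‖x‖ ≤ Real.exp 1 * (2 * M) := by
  have hy := shear_mem a hx
  rw [← quadrantProfile_apply ω₀ hy] at hne
  have h1 := h.upper_left _ _ hne
  have h2 := h.upper_right _ _ hne
  have h3 := h.lower _ _ hne
  have hM := h.pos_outer
  have hs : |a (x 0 * x 1)| ≤ 1 := by
    refine ha _ ⟨mul_nonneg hx.1 hx.2, ?_⟩
    rw [← shear_mul a x]
    nlinarith [mul_le_mul h1 h2 hy.2 hM.le]
  rw [← plane_norm_sq] at h3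
  constructor
  · rw [div_le_iff₀' (Real.exp_pos 1)]
    exact (le_of_sq_le_sq h3 (norm_nonneg _)).trans (norm_shear_le hs)
  · refine (le_norm_shear hs).trans ?_
    gcongr
    refine le_of_sq_le_sq ?_ (by positivity)
    rw [plane_norm_sq]
    nlinarith [mul_le_mul h1 h1 hy.1 hM.le, mul_le_mul h2 h2 hy.2 hM.le]

lemma isC10_shear (hω₀ : IsC10 ω₀) (h : IsProfile (quadrantProfile ω₀) δ M C) {a a' : ℝ → ℝ}
    (ha : ∀ s ∈ Icc 0 (M ^ 2 + 1), |a s| ≤ 1) (had : ∀ s, HasDerivAt a (a' s) s)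
    (ha' : Continuous a') : IsC10 fun x => ω₀ (shear a x) := by
  constructor
  · exact hω₀.1.comp (contDiff_shear had ha').contDiffOn fun x hx => shear_mem a hx
  · refine (isCompact_closedBall (0 : Plane) (Real.exp 1 * (2 * M))).of_isClosed_subset
      isClosed_closure (closure_minimal ?_ Metric.isClosed_closedBall)
    rintro x ⟨hx, hne⟩
    rw [mem_closedBall_zero_iff]
    exact (norm_bounds_of_shear_ne_zero h ha hx hne).2

lemma integrableOn_bsIntegrand_shear (hω₀ : IsC10 ω₀)
    (h : IsProfile (quadrantProfile ω₀) δ M C) {a : ℝ → ℝ}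
    (ha : ∀ s ∈ Icc 0 (M ^ 2 + 1), |a s| ≤ 1) (hac : Continuous a) (x : Plane) :
    IntegrableOn (bsIntegrand α fun x => ω₀ (shear a x)) (region x) := by
  have hδ : 0 < δ / Real.exp 1 := div_pos h.pos_inner (Real.exp_pos 1)
  set K : Set Plane := (quadrant ∩ {y | δ / Real.exp 1 ≤ ‖y‖}) ∩
    Metric.closedBall 0 (Real.exp 1 * (2 * M)) with hK
  have hKc : IsCompact K := (isCompact_closedBall _ _).inter_left
    (isClosed_quadrant.inter (isClosed_le continuous_const continuous_norm))
  have hcont : ContinuousOn (bsIntegrand α fun x => ω₀ (shear a x)) K := by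
    refine ContinuousOn.div ?_ ?_ fun y hy => ?_
    · refine hω₀.continuousOn.comp (Continuous.continuousOn ?_)
        fun y hy => shear_mem a hy.1.1
      exact (continuous_shear_uncurry (A := fun _ => a) (hac.comp continuous_snd)).comp
        (f := fun x : Plane => ((0 : ℝ), x)) (by fun_prop)
    · exact continuous_norm.continuousOn.rpow_const fun y hy => Or.inl (hδ.trans_le hy.1.2).ne'
    · exact (Real.rpow_pos_of_pos (hδ.trans_le hy.1.2) _).ne'
  refine ((hcont.integrableOn_compact hKc).of_forall_sdiff_eq_zero
    isClosed_quadrant.measurableSet fun y hy => ?_).mono_set fun y hy => hy.1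
  by_contra hne
  rw [bsIntegrand, div_eq_zero_iff, not_or] at hne
  obtain ⟨h1, h2⟩ := norm_bounds_of_shear_ne_zero h ha hy.1 hne.1
  exact hy.2 ⟨⟨hy.1, h1⟩, mem_closedBall_zero_iff.2 h2⟩

/-- The initial vorticity transported by a family of shears that solves the evolution equation
of the shear is a solution. -/
theorem isSolution_shear (hα : 0 ≤ α) (hω₀ : IsC10 ω₀) (h : IsProfile (quadrantProfile ω₀) δ M C)
    {T : ℝ} {A B : ℝ → ℝ → ℝ} (hA : Continuous fun z : ℝ × ℝ => A z.1 z.2)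
    (hB : Continuous fun z : ℝ × ℝ => B z.1 z.2) (hAB : ∀ t s, HasDerivAt (A t) (B t s) s)
    (hA0 : A 0 = 0) (hA1 : ∀ t, ∀ s ∈ Icc 0 (M ^ 2 + 1), |A t s| ≤ 1)
    (hAt : ∀ t ∈ Icc 0 T, ∀ s, 0 ≤ s → HasDerivWithinAt (fun τ => A τ s)
      (∫ σ in Ioi s, flux (1 + α / 2) (quadrantProfile ω₀) σ (A t σ)) (Icc 0 T) t) :
    IsSolution α ω₀ T fun t x => ω₀ (shear (A t) x) := by
  have hAc : ∀ t, Continuous (A t) := fun t => hA.comp (f := fun s => (t, s)) (by fun_prop)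
  have hBc : ∀ t, Continuous (B t) := fun t => hB.comp (f := fun s => (t, s)) (by fun_prop)
  have hdiff : ∀ y ∈ quadrant, HasFDerivWithinAt ω₀ (fderivWithin ℝ ω₀ quadrant y) quadrant y :=
    fun y hy => (hω₀.1.differentiableOn one_ne_zero y hy).hasFDerivWithinAt
  have hfd : ∀ t, ∀ x ∈ quadrant, fderivWithin ℝ (fun x => ω₀ (shear (A t) x)) quadrant x =
      (fderivWithin ℝ ω₀ quadrant (shear (A t) x)).comp (shearDeriv (A t) (B t) x) := by
    intro t x hx
    exact ((hdiff _ (shear_mem _ hx)).comp x (hasFDerivAt_shear (hAB t) x).hasFDerivWithinAt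
      fun y hy => shear_mem _ hy).fderivWithin (uniqueDiffOn_quadrant x hx)
  have hint : ∀ t x, IntegrableOn (bsIntegrand α fun x => ω₀ (shear (A t) x)) (region x) :=
    fun t x => integrableOn_bsIntegrand_shear hω₀ h (hA1 t) (hAc t) x
  have hzero : ∀ t, ∀ x ∈ quadrant, x ∉ Metric.closedBall 0 (Real.exp 1 * (2 * M)) →
      ω₀ (shear (A t) x) = 0 := by
    intro t x hx hxK
    by_contra hne
    exact hxK (mem_closedBall_zero_iff.2 (norm_bounds_of_shear_ne_zero h (hA1 t) hx hne).2)
  have hK : IsCompact (quadrant ∩ Metric.closedBall 0 (Real.exp 1 * (2 * M))) :=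
    (isCompact_closedBall _ _).inter_left isClosed_quadrant
  have hmaps : MapsTo (fun z : ℝ × Plane => shear (A z.1) z.2) (Icc 0 T ×ˢ quadrant) quadrant :=
    fun z hz => shear_mem _ hz.2
  refine ⟨⟨fun t _ => isC10_shear hω₀ h (hA1 t) (hAB t) (hBc t), fun t ht => ⟨?_, ?_⟩⟩, ?_,
    fun t _ x _ => hint t x, fun t ht x hx => ?_⟩
  · refine tendstoUniformlyOn_of_isCompact hK ?_ (fun t _ => hzero t) ht
    exact hω₀.continuousOn.comp (continuous_shear_uncurry hA).continuousOn hmaps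
  · refine tendstoUniformlyOn_of_isCompact hK ?_ (fun t _ x hx hxK => ?_) ht
    · refine ContinuousOn.congr (f := fun z : ℝ × Plane =>
        (fderivWithin ℝ ω₀ quadrant (shear (A z.1) z.2)).comp
          (shearDeriv (A z.1) (B z.1) z.2)) ?_ fun z hz => hfd z.1 z.2 hz.2
      exact ((hω₀.1.continuousOn_fderivWithin uniqueDiffOn_quadrant le_rfl).comp
        (continuous_shear_uncurry hA).continuousOn hmaps).clm_comp
        (continuous_shearDeriv hA hB).continuousOn
    · have hev : (fun x => ω₀ (shear (A t) x)) =ᶠ[𝓝[quadrant] x] fun _ => 0 := by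
        filter_upwards [self_mem_nhdsWithin,
          nhdsWithin_le_nhds (Metric.isClosed_closedBall.isOpen_compl.mem_nhds hxK)] with y hy hyK
        exact hzero t y hy hyK
      rw [hev.fderivWithin_eq (hzero t x hx hxK)]
      simp
  · intro x _
    simp only [hA0, shear_zero]
  · obtain ⟨-, hΩ⟩ := bigOmega_eq_integral_flux hα h (fun _ _ _ => rfl) hx (hint t x)
    have hd := hasDerivWithinAt_shear (x := x) (hAt t ht _ (mul_nonneg hx.1 hx.2))
    rw [← hΩ] at hd
    refine ⟨_, (hdiff _ (shear_mem (A t) hx)).comp_hasDerivWithinAt t hd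
      fun s _ => shear_mem (A s) hx, ?_⟩
    rw [hfd t x hx, ContinuousLinearMap.comp_apply, shearDeriv_velocity, map_neg]
    exact add_neg_cancel _

end

/-! ### The velocity off the axes -/

lemma isClosed_region (x : Plane) : IsClosed (region x) := by
  have h : IsClosed {y : Plane | x 0 * x 1 ≤ y 0 * y 1} :=
    isClosed_le continuous_const (by fun_prop)
  exact isClosed_quadrant.inter h

lemma region_anti {x y : Plane} (h : x 0 * x 1 ≤ y 0 * y 1) : region y ⊆ region x :=
  fun _ hz => ⟨hz.1, h.trans hz.2⟩

lemma bigOmega_congr (α : ℝ) (f : Plane → ℝ) {x y : Plane} (h : x 0 * x 1 = y 0 * y 1) :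
    bigOmega α f x = bigOmega α f y := by
  rw [bigOmega, bigOmega, (region_anti h.le).antisymm (region_anti h.ge)]

lemma pos_of_mem_region {x y : Plane} (hx : 0 < x 0 * x 1) (hy : y ∈ region x) :
    0 < y 0 ∧ 0 < y 1 := by
  have h := hx.trans_le hy.2
  exact ⟨pos_of_mul_pos_left h hy.1.2, pos_of_mul_pos_right h hy.1.1⟩

/-- Away from the axes the region of integration avoids a neighbourhood of the origin, and the
kernel decays fast enough to be integrable at infinity. -/
lemma integrableOn_kernel {α : ℝ} (hα : 0 < α) {x : Plane} (hx : 0 < x 0 * x 1) :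
    IntegrableOn (fun y : Plane => (‖y‖ ^ (2 + α))⁻¹) (region x) := by
  set c := √(x 0 * x 1) with hc
  have hc0 : 0 < c := Real.sqrt_pos.2 hx
  have hdim : (Module.finrank ℝ Plane : ℝ) < 2 + α := by simp [hα]
  refine Integrable.mono' (((integrable_one_add_norm (μ := volume) hdim).const_mul
    ((1 + 1 / c) ^ (2 + α))).integrableOn (s := region x)) ?_ ?_
  · refine Measurable.aestronglyMeasurable ?_
    fun_prop
  · refine (ae_restrict_iff' (isClosed_region x).measurableSet).2 (ae_of_all _ fun y hy => ?_)
    have hyc : c ≤ ‖y‖ := by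
      rw [hc, Real.sqrt_le_left (norm_nonneg _), plane_norm_sq]
      nlinarith [hy.2, sq_nonneg (y 0 - y 1), hx]
    have hy0 := hc0.trans_le hyc
    rw [Real.norm_of_nonneg (by positivity), Real.rpow_neg (by positivity), ← div_eq_mul_inv,
      inv_le_comm₀ (by positivity) (by positivity), inv_div, ← Real.div_rpow (by positivity)
      (by positivity)]
    gcongr
    rw [div_le_iff₀ (by positivity), mul_add, mul_one, mul_one_div, add_comm]
    gcongr
    rwa [one_le_div hc0]

lemma abs_bigOmega_sub_le {α : ℝ} (hα : 0 < α) {x : Plane} (hx : 0 < x 0 * x 1)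
    {f g : Plane → ℝ} {ε : ℝ} (hf : IntegrableOn (bsIntegrand α f) (region x))
    (hg : IntegrableOn (bsIntegrand α g) (region x)) (h : ∀ y ∈ region x, |f y - g y| ≤ ε) :
    |bigOmega α f x - bigOmega α g x| ≤ ε * ∫ y in region x, (‖y‖ ^ (2 + α))⁻¹ := by
  rw [bigOmega, bigOmega, ← integral_sub hf hg, ← integral_const_mul]
  refine (Real.norm_eq_abs _).symm.le.trans (norm_integral_le_of_norm_le
    ((integrableOn_kernel hα hx).const_mul ε)
    ((ae_restrict_iff' (isClosed_region x).measurableSet).2 (ae_of_all _ fun y hy => ?_)))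
  rw [bsIntegrand, bsIntegrand, ← sub_div, Real.norm_eq_abs, abs_div, div_eq_mul_inv,
    abs_of_nonneg (Real.rpow_nonneg (norm_nonneg y) _)]
  gcongr
  exact h y hy

lemma abs_bigOmega_le {α : ℝ} (hα : 0 < α) {x z : Plane} (hx : 0 < x 0 * x 1)
    (hz : x 0 * x 1 ≤ z 0 * z 1) {f : Plane → ℝ} {C : ℝ} (hC : 0 ≤ C)
    (hf : IntegrableOn (bsIntegrand α f) (region z)) (h : ∀ y ∈ region z, |f y| ≤ C) :
    |bigOmega α f z| ≤ C * ∫ y in region x, (‖y‖ ^ (2 + α))⁻¹ := by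
  have hb : bsIntegrand α (fun _ => 0) = fun _ => 0 := by ext y; simp [bsIntegrand]
  have h1 := abs_bigOmega_sub_le hα (hx.trans_le hz) (g := fun _ => 0) (ε := C) hf
    (by rw [hb]; exact integrableOn_zero) (fun y hy => by simpa using h y hy)
  have h2 : bigOmega α (fun _ => 0) z = 0 := by rw [bigOmega, hb]; simp
  rw [h2, sub_zero] at h1
  refine h1.trans (mul_le_mul_of_nonneg_left ?_ hC)
  exact setIntegral_mono_set (integrableOn_kernel hα hx)
    (ae_of_all _ fun y => inv_nonneg.2 (Real.rpow_nonneg (norm_nonneg y) _))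
    (LE.le.eventuallyLE (region_anti hz))

/-! ### Transport along trajectories -/

/-- The chain rule for a path in `C¹₀(R)` along a curve in the quadrant. Joint differentiability is
not available a priori; the mean value inequality on the convex quadrant and the uniform
convergence of the gradients replace it. -/
lemma IsC10Path.hasDerivWithinAt_comp {I : Set ℝ} {ω : ℝ → Plane → ℝ} (hω : IsC10Path I ω)
    {γ : ℝ → Plane} {t : ℝ} {v : Plane} {c : ℝ} (ht : t ∈ I) (hγ : ∀ τ ∈ I, γ τ ∈ quadrant)
    (hγt : HasDerivWithinAt γ v I t) (hc : HasDerivWithinAt (fun τ => ω τ (γ t)) c I t) :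
    HasDerivWithinAt (fun τ => ω τ (γ τ)) (c + fderivWithin ℝ (ω t) quadrant (γ t) v) I t := by
  set D := fderivWithin ℝ (ω t) quadrant (γ t) with hD
  set g : ℝ → ℝ := fun τ => ω τ (γ τ) - ω τ (γ t) - D (γ τ - γ t) with hg
  have hlo : g =o[𝓝[I] t] fun τ => γ τ - γ t := by
    refine Asymptotics.isLittleO_iff.2 fun ε hε => ?_
    have hunif := Metric.tendstoUniformlyOn_iff.1 (hω.2 t ht).2 (ε / 2) (half_pos hε)
    have hDc := (hω.1 t ht).1.continuousOn_fderivWithin uniqueDiffOn_quadrant le_rfl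
    obtain ⟨r, hr, hball⟩ := Metric.continuousWithinAt_iff.1 (hDc (γ t) (hγ t ht)) (ε / 2)
      (half_pos hε)
    have hnear := Metric.tendsto_nhds.1 hγt.continuousWithinAt r hr
    filter_upwards [hunif, hnear, self_mem_nhdsWithin] with τ h1 h2 hτ
    refine Convex.norm_image_sub_le_of_norm_hasFDerivWithin_le'
      (s := quadrant ∩ Metric.ball (γ t) r) (f' := fderivWithin ℝ (ω τ) quadrant) (φ := D)
      (fun x hx => (((hω.1 τ hτ).1.differentiableOn one_ne_zero x hx.1).hasFDerivWithinAt).mono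
        inter_subset_left) (fun x hx => ?_) (convex_quadrant.inter (convex_ball _ _))
      ⟨hγ t ht, Metric.mem_ball_self hr⟩ ⟨hγ τ hτ, h2⟩
    have e1 := h1 x hx.1
    have e2 := hball hx.1 hx.2
    rw [← dist_eq_norm]
    rw [dist_comm] at e1
    linarith [dist_triangle (fderivWithin ℝ (ω τ) quadrant x) (fderivWithin ℝ (ω t) quadrant x) D]
  have hgd : HasDerivWithinAt g 0 I t := by
    rw [hasDerivWithinAt_iff_isLittleO]
    have hgt : g t = 0 := by simp [hg]
    simp only [hgt, sub_zero, smul_zero]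
    exact hlo.trans_isBigO
      (hγt.isBigO_sub.comp_tendsto (tendsto_id.prodMk tendsto_const_pure))
  have hDd : HasDerivWithinAt (fun τ => D (γ τ - γ t)) (D v) I t :=
    D.hasFDerivAt.comp_hasDerivWithinAt t (hγt.sub_const _)
  have hsum := (hgd.add hc).add hDd
  rw [zero_add] at hsum
  refine hsum.congr_of_mem (fun τ _ => ?_) ht
  simp only [hg, Pi.add_apply]
  ring

section

variable {α : ℝ} {ω₀ : Plane → ℝ} {T : ℝ} {ω : ℝ → Plane → ℝ}

/-- The parameter of the hyperbolic rotation that the flow of `ω` induces, up to time `t`, on the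
hyperbola `x₁ x₂ = s`. -/
noncomputable def flowShear (α : ℝ) (ω : ℝ → Plane → ℝ) (t s : ℝ) : ℝ :=
  ∫ τ in (0 : ℝ)..t, bigOmega α (ω τ) (hypPoint s 0)

lemma IsSolution.continuousOn_bigOmega (hα : 0 < α) (h : IsSolution α ω₀ T ω) {x : Plane}
    (hx : x ∈ quadrant) (hpos : 0 < x 0 * x 1) :
    ContinuousOn (fun t => bigOmega α (ω t) x) (Icc 0 T) := by
  intro t ht
  set J := ∫ y in region x, (‖y‖ ^ (2 + α))⁻¹ with hJ
  have hJ0 : 0 ≤ J := integral_nonneg fun y => inv_nonneg.2 (Real.rpow_nonneg (norm_nonneg y) _)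
  refine Metric.tendsto_nhds.2 fun ε hε => ?_
  have hε' : 0 < ε / (J + 1) := by positivity
  filter_upwards [Metric.tendstoUniformlyOn_iff.1 (h.path.2 t ht).1 _ hε',
    self_mem_nhdsWithin] with τ h1 hτ
  have := abs_bigOmega_sub_le hα hpos (h.converges τ hτ x hx) (h.converges t ht x hx)
    (ε := ε / (J + 1)) fun y hy => by
      have := h1 y hy.1
      rw [dist_comm, Real.dist_eq] at this
      exact this.le
  rw [Real.dist_eq]
  refine this.trans_lt ?_
  rw [← hJ, div_mul_eq_mul_div, div_lt_iff₀ (by positivity)]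
  nlinarith

lemma IsSolution.hasDerivWithinAt_flowShear (hα : 0 < α) (h : IsSolution α ω₀ T ω) {x : Plane}
    (hx : x ∈ quadrant) (hpos : 0 < x 0 * x 1) {t : ℝ} (ht : t ∈ Icc 0 T) :
    HasDerivWithinAt (fun τ => flowShear α ω τ (x 0 * x 1)) (bigOmega α (ω t) x) (Icc 0 T) t := by
  have hc := h.continuousOn_bigOmega hα hx hpos
  have heq : ∀ τ, bigOmega α (ω τ) (hypPoint (x 0 * x 1) 0) = bigOmega α (ω τ) x := fun τ =>
    bigOmega_congr α _ (hypPoint_mul _ _)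
  unfold flowShear
  simp only [heq]
  have : Fact (t ∈ Icc 0 T) := ⟨ht⟩
  refine intervalIntegral.integral_hasDerivWithinAt_right ?_
    (hc.stronglyMeasurableAtFilter_nhdsWithin measurableSet_Icc t) (hc t ht)
  refine (hc.mono ?_).intervalIntegrable
  exact uIcc_subset_Icc ⟨le_rfl, ht.1.trans ht.2⟩ ht

/-- Off the axes a solution is the initial vorticity transported by its flow. -/
lemma IsSolution.eq_shear (hα : 0 < α) (h : IsSolution α ω₀ T ω) {t : ℝ} (ht : t ∈ Icc 0 T)
    {x : Plane} (hx0 : 0 < x 0) (hx1 : 0 < x 1) : ω t x = ω₀ (shear (flowShear α ω t) x) := by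
  have hxQ : x ∈ quadrant := ⟨hx0.le, hx1.le⟩
  set y := shear (flowShear α ω t) x with hy
  have hyQ : y ∈ quadrant := shear_mem _ hxQ
  have hypos : 0 < y 0 * y 1 := by rw [hy, shear_mul]; exact mul_pos hx0 hx1
  set γ : ℝ → Plane := fun τ => shear (-flowShear α ω τ) y with hγ
  have hγQ : ∀ τ, γ τ ∈ quadrant := fun τ => shear_mem _ hyQ
  have hder : ∀ τ ∈ Icc 0 T, HasDerivWithinAt (fun τ => ω τ (γ τ)) 0 (Icc 0 T) τ := by
    intro τ hτ
    have hd := hasDerivWithinAt_shear (A := fun τ => -flowShear α ω τ) (x := y)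
      (h.hasDerivWithinAt_flowShear hα hyQ hypos hτ).neg
    obtain ⟨c, hc, he⟩ := h.equation τ hτ (γ τ) (hγQ τ)
    have hv : velocity α (ω τ) (γ τ) =
        !₂[γ τ 0 * -bigOmega α (ω τ) y, -(γ τ 1 * -bigOmega α (ω τ) y)] := by
      rw [velocity, bigOmega_congr α (ω τ) (shear_mul _ y)]
      simp
    rw [hv] at he
    exact (h.path.hasDerivWithinAt_comp hτ (fun τ _ => hγQ τ) hd hc).congr_deriv he
  have hconst := constant_of_derivWithin_zero (fun τ hτ => (hder τ hτ).differentiableWithinAt)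
    (fun τ hτ => (hder τ (Ico_subset_Icc_self hτ)).derivWithin
      (uniqueDiffOn_Icc (hτ.1.trans_lt hτ.2) τ (Ico_subset_Icc_self hτ))) t ht
  have h0 : flowShear α ω 0 = 0 := by ext s; simp [flowShear]
  have e1 : γ t = x := by
    rw [hγ, hy]
    simp only
    rw [shear_shear, neg_add_cancel, shear_zero]
  have e0 : γ 0 = y := by
    rw [hγ]
    simp only [h0, neg_zero, shear_zero]
  rw [e1, e0, h.initial y hyQ] at hconst
  exact hconst

/-! ### Uniqueness -/

variable {δ M C : ℝ}

lemma IsSolution.bigOmega_hypPoint (hα : 0 < α) (hp : IsProfile (quadrantProfile ω₀) δ M C)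
    (h : IsSolution α ω₀ T ω) {t s : ℝ} (ht : t ∈ Icc 0 T) (hs : 0 < s) :
    IntegrableOn (fun σ => flux (1 + α / 2) (quadrantProfile ω₀) σ (flowShear α ω t σ)) (Ioi s) ∧
    bigOmega α (ω t) (hypPoint s 0) =
      ∫ σ in Ioi s, flux (1 + α / 2) (quadrantProfile ω₀) σ (flowShear α ω t σ) := by
  have := bigOmega_eq_integral_flux hα.le hp (fun x h0 h1 => h.eq_shear hα ht h0 h1)
    (hypPoint_mem hs.le 0) (h.converges t ht _ (hypPoint_mem hs.le 0))
  rwa [hypPoint_mul] at this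

lemma IsSolution.abs_bigOmega_hypPoint_le (hα : 0 < α)
    (hp : IsProfile (quadrantProfile ω₀) δ M C) (h : IsSolution α ω₀ T ω) {t s₀ s : ℝ}
    (ht : t ∈ Icc 0 T) (hs₀ : 0 < s₀) (hs : s₀ ≤ s) :
    |bigOmega α (ω t) (hypPoint s 0)| ≤
      C * ∫ y in region (hypPoint s₀ 0), (‖y‖ ^ (2 + α))⁻¹ := by
  have hs' := hs₀.trans_le hs
  refine abs_bigOmega_le hα (by rwa [hypPoint_mul]) (by rwa [hypPoint_mul, hypPoint_mul])
    hp.nonneg (h.converges t ht _ (hypPoint_mem hs'.le 0)) fun y hy => ?_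
  obtain ⟨h0, h1⟩ := pos_of_mem_region (by rwa [hypPoint_mul]) hy
  rw [h.eq_shear hα ht h0 h1, ← quadrantProfile_apply ω₀ (shear_mem _ hy.1)]
  exact hp.bound _ _

lemma IsSolution.intervalIntegrable_bigOmega (hα : 0 < α) (h : IsSolution α ω₀ T ω) {t s : ℝ}
    (ht : t ∈ Icc 0 T) (hs : 0 < s) :
    IntervalIntegrable (fun τ => bigOmega α (ω τ) (hypPoint s 0)) volume 0 t :=
  ((h.continuousOn_bigOmega hα (hypPoint_mem hs.le 0) (by rwa [hypPoint_mul])).mono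
    (uIcc_subset_Icc ⟨le_rfl, ht.1.trans ht.2⟩ ht)).intervalIntegrable

/-- Two solutions have the same flow off the axes. On the hyperbolas with parameter at least `s₀`
the velocity is determined by the vorticity on these same hyperbolas, it is bounded there, and
Grönwall's argument applies. -/
lemma IsSolution.flowShear_eq (hα : 0 < α) (hp : IsProfile (quadrantProfile ω₀) δ M C)
    {ω' : ℝ → Plane → ℝ} (h : IsSolution α ω₀ T ω) (h' : IsSolution α ω₀ T ω') {t s₀ : ℝ}
    (ht : t ∈ Icc 0 T) (hs₀ : 0 < s₀) : flowShear α ω t s₀ = flowShear α ω' t s₀ := by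
  set N := C * ∫ y in region (hypPoint s₀ 0), (‖y‖ ^ (2 + α))⁻¹ with hN
  have hN0 : 0 ≤ N := mul_nonneg hp.nonneg
    (integral_nonneg fun y => inv_nonneg.2 (Real.rpow_nonneg (norm_nonneg y) _))
  have hbound : ∀ υ : ℝ → Plane → ℝ, IsSolution α ω₀ T υ → ∀ t ∈ Icc 0 T, ∀ s, s₀ ≤ s →
      |flowShear α υ t s| ≤ N * T := by
    intro υ hυ t ht s hs
    have := intervalIntegral.norm_integral_le_of_norm_le_const (a := 0) (b := t) (C := N)
      (f := fun τ => bigOmega α (υ τ) (hypPoint s 0)) fun τ hτ => by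
        rw [uIoc_of_le ht.1] at hτ
        exact hυ.abs_bigOmega_hypPoint_le hα hp ⟨hτ.1.le, hτ.2.trans ht.2⟩ hs₀ hs
    rw [sub_zero, abs_of_nonneg ht.1] at this
    exact this.trans (mul_le_mul_of_nonneg_left ht.2 hN0)
  obtain ⟨L, hL, hlip⟩ := exists_lipschitz_flux (β := 1 + α / 2) (by positivity) hp (N * T)
  set P := L * M ^ 2 + 1 with hP
  have hP0 : 0 < P := by positivity
  have hΩ : ∀ t ∈ Icc 0 T, ∀ K, (∀ s, s₀ ≤ s → |flowShear α ω t s - flowShear α ω' t s| ≤ K) →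
      ∀ s, s₀ ≤ s → |bigOmega α (ω t) (hypPoint s 0) - bigOmega α (ω' t) (hypPoint s 0)| ≤
        P * K := by
    intro t ht K hK s hs
    have hK0 : 0 ≤ K := (abs_nonneg _).trans (hK s hs)
    obtain ⟨i1, e1⟩ := h.bigOmega_hypPoint hα hp ht (hs₀.trans_le hs)
    obtain ⟨i2, e2⟩ := h'.bigOmega_hypPoint hα hp ht (hs₀.trans_le hs)
    rw [e1, e2, ← integral_sub i1 i2, setIntegral_eq_of_subset_of_forall_sdiff_eq_zero
      measurableSet_Ioi (show Ioc s (M ^ 2) ⊆ Ioi s from Ioc_subset_Ioi_self)]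
    · have hle := norm_setIntegral_le_of_norm_le_const (s := Ioc s (M ^ 2)) (μ := volume)
        (C := L * K) (f := fun σ => flux (1 + α / 2) (quadrantProfile ω₀) σ (flowShear α ω t σ) -
          flux (1 + α / 2) (quadrantProfile ω₀) σ (flowShear α ω' t σ)) measure_Ioc_lt_top
        fun σ hσ => (hlip σ _ _ (hbound ω h t ht σ (hs.trans hσ.1.le))
          (hbound ω' h' t ht σ (hs.trans hσ.1.le))).trans
          (mul_le_mul_of_nonneg_left (hK σ (hs.trans hσ.1.le)) hL)
      refine hle.trans ?_
      have hvol : volume.real (Ioc s (M ^ 2)) ≤ M ^ 2 := by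
        rw [Real.volume_real_Ioc]
        exact max_le (by linarith) (sq_nonneg M)
      calc L * K * volume.real (Ioc s (M ^ 2)) ≤ L * K * M ^ 2 := by gcongr
        _ ≤ P * K := by rw [hP]; nlinarith
    · intro σ hσ
      have hσM : M ^ 2 < σ := by
        by_contra hle
        exact hσ.2 ⟨hσ.1, not_lt.1 hle⟩
      rw [flux_eq_zero hp hσM, flux_eq_zero hp hσM, sub_zero]
  -- The weight `e^{2Pt}` turns Grönwall's argument into a contraction by the factor `1/2`.
  have hstep : ∀ m : ℝ, (∀ t ∈ Icc 0 T, ∀ s, s₀ ≤ s →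
      |flowShear α ω t s - flowShear α ω' t s| ≤ m * Real.exp (2 * P * t)) →
      ∀ t ∈ Icc 0 T, ∀ s, s₀ ≤ s →
        |flowShear α ω t s - flowShear α ω' t s| ≤ m / 2 * Real.exp (2 * P * t) := by
    intro m hm t ht s hs
    have hm0 : 0 ≤ m := by
      have := (abs_nonneg _).trans (hm t ht s hs)
      exact nonneg_of_mul_nonneg_left this (Real.exp_pos _)
    have hFTC : ∫ τ in (0 : ℝ)..t, P * (m * Real.exp (2 * P * τ)) =
        m / 2 * Real.exp (2 * P * t) - m / 2 * Real.exp (2 * P * 0) := by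
      refine intervalIntegral.integral_eq_sub_of_hasDerivAt
        (f := fun τ => m / 2 * Real.exp (2 * P * τ)) (fun τ _ => ?_)
        (Continuous.intervalIntegrable (by fun_prop) _ _)
      have hd : HasDerivAt (fun τ : ℝ => 2 * P * τ) (2 * P) τ := by
        simpa using (hasDerivAt_id τ).const_mul (2 * P)
      refine (hd.exp.const_mul (m / 2)).congr_deriv ?_
      ring
    unfold flowShear
    rw [← intervalIntegral.integral_sub
      (h.intervalIntegrable_bigOmega hα ht (hs₀.trans_le hs))
      (h'.intervalIntegrable_bigOmega hα ht (hs₀.trans_le hs)), ← Real.norm_eq_abs]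
    refine (intervalIntegral.norm_integral_le_of_norm_le (a := 0) (b := t) ht.1
      (g := fun τ => P * (m * Real.exp (2 * P * τ))) (ae_of_all _ fun τ hτ => ?_)
      (Continuous.intervalIntegrable (by fun_prop) _ _)).trans ?_
    · have hτ' : τ ∈ Icc 0 T := ⟨hτ.1.le, hτ.2.trans ht.2⟩
      exact hΩ τ hτ' _ (hm τ hτ') s hs
    · rw [hFTC]
      have := Real.exp_pos (2 * P * 0)
      nlinarith
  have hiter : ∀ n : ℕ, ∀ t ∈ Icc 0 T, ∀ s, s₀ ≤ s →
      |flowShear α ω t s - flowShear α ω' t s| ≤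
        2 * (N * T) * (1 / 2) ^ n * Real.exp (2 * P * t) := by
    intro n
    induction n with
    | zero =>
      intro t ht s hs
      have hT : 0 ≤ T := ht.1.trans ht.2
      have e1 := hbound ω h t ht s hs
      have e2 := hbound ω' h' t ht s hs
      have e3 : 1 ≤ Real.exp (2 * P * t) := Real.one_le_exp (by have := ht.1; positivity)
      have e4 := abs_sub (flowShear α ω t s) (flowShear α ω' t s)
      nlinarith [mul_nonneg hN0 hT]
    | succ n ih =>
      intro t ht s hs
      refine (hstep _ ih t ht s hs).trans_eq ?_
      ring
  have hlim : Tendsto (fun n : ℕ => 2 * (N * T) * (1 / 2) ^ n * Real.exp (2 * P * t)) atTop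
      (𝓝 0) := by
    simpa using ((tendsto_pow_atTop_nhds_zero_of_lt_one (r := (1 / 2 : ℝ)) (by norm_num)
      (by norm_num)).const_mul (2 * (N * T))).mul_const (Real.exp (2 * P * t))
  have := ge_of_tendsto' hlim fun n => hiter n t ht s₀ le_rfl
  exact sub_eq_zero.1 (abs_nonpos_iff.1 this)

theorem IsSolution.eqOn (hα : 0 < α) (hp : IsProfile (quadrantProfile ω₀) δ M C)
    {ω' : ℝ → Plane → ℝ} (h : IsSolution α ω₀ T ω) (h' : IsSolution α ω₀ T ω') {t : ℝ}
    (ht : t ∈ Icc 0 T) : EqOn (ω t) (ω' t) quadrant := by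
  refine eqOn_quadrant_of_eqOn_pos (h.path.1 t ht).continuousOn (h'.path.1 t ht).continuousOn
    fun x h0 h1 => ?_
  rw [h.eq_shear hα ht h0 h1, h'.eq_shear hα ht h0 h1]
  simp only [shear, h.flowShear_eq hα hp h' ht (mul_pos h0 h1)]

end

end HyperbolicSQG

theorem theorem1 (α : ℝ) (hα : 0 < α) (hα1 : α < 1) (ω₀ : HyperbolicSQG.Plane → ℝ)
    (hω₀ : HyperbolicSQG.IsC10 ω₀)
    (h0 : (0 : HyperbolicSQG.Plane) ∉ HyperbolicSQG.quadrantSupport ω₀) :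
    ∃ T : ℝ, 0 < T ∧
      ∃ ω : ℝ → HyperbolicSQG.Plane → ℝ,
        HyperbolicSQG.IsSolution α ω₀ T ω ∧
        ∀ ω' : ℝ → HyperbolicSQG.Plane → ℝ, HyperbolicSQG.IsSolution α ω₀ T ω' →
          ∀ t ∈ Set.Icc (0 : ℝ) T, ∀ x ∈ HyperbolicSQG.quadrant, ω' t x = ω t x := by
  obtain ⟨δ, M, C, hp⟩ := hω₀.exists_isProfile h0
  have hβ : 0 ≤ 1 + α / 2 := by positivity
  obtain ⟨L, hL, hlip⟩ := HyperbolicSQG.exists_lipschitz_flux hβ hp 1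
  obtain ⟨T, hT, A, B, hA, hB, hAB, hA0, hA1, hAt⟩ := HyperbolicSQG.exists_shear_path
    (S := M ^ 2 + 1) (by positivity) hL (HyperbolicSQG.continuous_flux hβ hp)
    (fun σ a hσ => HyperbolicSQG.flux_eq_zero hp (by linarith) a) hlip
  have hsol := HyperbolicSQG.isSolution_shear hα.le hω₀ hp hA (B := fun t s => -B t s) hB.neg
    hAB hA0 hA1 hAt
  exact ⟨T, hT, _, hsol, fun ω' hω' t ht => hω'.eqOn hα hp hsol ht⟩
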